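/- **Setting.** Let $A\in\mathbb C^{n\times n}$ have all its eigenvalues in the open unit disc, let $B\in\mathbb C^{n\times m}$ have full column rank $m$, and let $(A,B)$ be reachable (the columns of $B,AB,\dots,A^{n-1}B$ span $\mathbb C^n$). Put $G(z)=(zI-A)^{-1}B$. All integrals are over the unit circle $\mathbb T$ with respect to $d\vartheta/2\pi$, and $G^*$ is the conjugate transpose of $G$ on $\mathbb T$. Let $\mathcal S_+^{m\times m}(\mathbb T)$ be the set of measurable Hermitian $\mathbb C^{m\times m}$-valued functions $\Phi$ on $\mathbb T$ (identified when equal almost everywhere) with $cI\le\Phi\le CI$ a.e. for some constants $c>0$, $C$. Let $P_\Gamma$ be the set of positive definite matrices of the form $\int G\Phi G^*$ with $\Phi$ a continuous function from $\mathbb T$ to the Hermitian $m\times m$ matrices. For $\Phi,\Psi\in\mathcal S_+^{m\times m}(\mathbb T)$ the Hellinger distance is $$d_H(\Phi,\Psi)=\inf\{\|W_\Psi-W_\Phi\|_2:\ W_\Psi,W_\Phi\in L_2^{m\times m},\ W_\Psi W_\Psi^*=\Psi,\ W_\Phi W_\Phi^*=\Phi\}.$$ Fix $\Psi\in\mathcal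 S_+^{m\times m}(\mathbb T)$. **Statement.** For every $S\in P_\Gamma$ the problem of minimizing $d_H(\Phi,\Psi)$ over all $\Phi\in\mathcal S_+^{m\times m}(\mathbb T)$ with $\int G\Phi G^*=S$ has exactly one solution, denoted $\Phi^H_{\rm opt}(S)$ (uniqueness up to equality almost everywhere). Moreover, let $\Sigma\in P_\Gamma$ and let $(\bar\Sigma_N)_N$ be random matrices on a probability space, with values in $P_\Gamma$ (almost surely), such that $$\lim_{N\to\infty}\bar\Sigma_N=\Sigma\quad\text{a.s.}$$ Then $$\lim_{N\to\infty}\big\|\Phi^H_{\rm opt}(\bar\Sigma_N)-\Phi^H_{\rm opt}(\Sigma)\big\|_\infty=0\quad\text{a.s.},$$ where $\|\cdot\|_\infty$ is the norm of $L_\infty^{m\times m}(\mathbb T)$, the essential supremum of the spectral norm. -/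

import Mathlib

open MeasureTheory Filter Topology
open scoped Matrix ENNReal ComplexOrder

/-- The unit circle `𝕋`, parametrized by the angle `ϑ` modulo `2π`. -/
abbrev UnitTorus : Type := AddCircle (2 * Real.pi)

/-- The period `2π` is positive. -/
instance instFactTwoPiPos : Fact (0 < 2 * Real.pi) := ⟨Real.two_pi_pos⟩

/-- The normalized Lebesgue measure `dϑ / 2π` on the unit circle. -/
noncomputable abbrev torusMeasure : Measure UnitTorus := AddCircle.haarAddCircle

section System

variable {n m : ℕ}

/-- `A` is a stability matrix: all its eigenvalues lie in the open unit disc. -/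
def IsStabilityMatrix (A : Matrix (Fin n) (Fin n) ℂ) : Prop :=
  ∀ μ ∈ spectrum ℂ A, ‖μ‖ < 1

/-- `(A, B)` is a reachable pair: the columns of `B, A B, …, A ^ (n - 1) B` span `ℂⁿ`. -/
def IsReachablePair (A : Matrix (Fin n) (Fin n) ℂ) (B : Matrix (Fin n) (Fin m) ℂ) : Prop :=
  Submodule.span ℂ {v : Fin n → ℂ | ∃ k < n, ∃ j : Fin m, v = (A ^ k * B).col j} = ⊤

/-- The transfer function `G(z) = (z I - A)⁻¹ B` at the point `z = e^{iϑ}` of the unit circle. -/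
noncomputable def transferFunction (A : Matrix (Fin n) (Fin n) ℂ) (B : Matrix (Fin n) (Fin m) ℂ)
    (θ : UnitTorus) : Matrix (Fin n) (Fin m) ℂ :=
  ((AddCircle.toCircle θ : ℂ) • (1 : Matrix (Fin n) (Fin n) ℂ) - A)⁻¹ * B

/-- The matrix `∫ G Φ G^*`, computed entry by entry; on the unit circle `G^*` is the conjugate
transpose of `G`. -/
noncomputable def stateCovariance (A : Matrix (Fin n) (Fin n) ℂ) (B : Matrix (Fin n) (Fin m) ℂ)
    (Φ : UnitTorus → Matrix (Fin m) (Fin m) ℂ) : Matrix (Fin n) (Fin n) ℂ :=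
  Matrix.of fun i j =>
    ∫ θ, (transferFunction A B θ * Φ θ * (transferFunction A B θ)ᴴ) i j ∂torusMeasure

/-- The range of `Γ : C(𝕋; ℍ(m)) → ℍ(n)`, `Γ(Φ) = ∫ G Φ G^*`. -/
def rangeGamma (A : Matrix (Fin n) (Fin n) ℂ) (B : Matrix (Fin n) (Fin m) ℂ) :
    Set (Matrix (Fin n) (Fin n) ℂ) :=
  {S | ∃ Φ : UnitTorus → Matrix (Fin m) (Fin m) ℂ,
    Continuous Φ ∧ (∀ θ, (Φ θ).IsHermitian) ∧ stateCovariance A B Φ = S}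

/-- The set `P_Γ` of the positive definite matrices in the range of `Γ`. -/
def PGamma (A : Matrix (Fin n) (Fin n) ℂ) (B : Matrix (Fin n) (Fin m) ℂ) :
    Set (Matrix (Fin n) (Fin n) ℂ) :=
  {S | S ∈ rangeGamma A B ∧ S.PosDef}

end System

section Spectra

variable {m : ℕ}

/-- The family `S_+^{m×m}(𝕋)` of bounded and coercive (Hermitian) spectral densities:
measurable `Φ` with `c I ≤ Φ ≤ C I` almost everywhere, for some constants `c > 0` and `C`. -/
def IsSpectralDensity (Φ : UnitTorus → Matrix (Fin m) (Fin m) ℂ) : Prop :=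
  (∀ i j, AEStronglyMeasurable (fun θ => Φ θ i j) torusMeasure) ∧
  ∃ c C : ℝ, 0 < c ∧ ∀ᵐ θ ∂torusMeasure,
    (Φ θ - (c : ℂ) • (1 : Matrix (Fin m) (Fin m) ℂ)).PosSemidef ∧
    ((C : ℂ) • (1 : Matrix (Fin m) (Fin m) ℂ) - Φ θ).PosSemidef

/-- `W` is a square spectral factor of `Φ`: `W ∈ L₂^{m×m}` and `W W^* = Φ`. -/
def IsSpectralFactor (W Φ : UnitTorus → Matrix (Fin m) (Fin m) ℂ) : Prop :=
  (∀ i j, MemLp (fun θ => W θ i j) 2 torusMeasure) ∧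
  ∀ᵐ θ ∂torusMeasure, W θ * (W θ)ᴴ = Φ θ

/-- The `L₂^{m×m}` norm `(tr ∫ V V^*)^{1/2} = (∫ ∑ |V_{ij}|²)^{1/2}`. -/
noncomputable def matrixL2Norm (V : UnitTorus → Matrix (Fin m) (Fin m) ℂ) : ℝ≥0∞ :=
  (∫⁻ θ, ∑ i, ∑ j, ‖V θ i j‖ₑ ^ 2 ∂torusMeasure) ^ (1 / 2 : ℝ)

/-- The multivariable Hellinger distance
`d_H(Φ, Ψ) = inf {‖W_Ψ - W_Φ‖₂ : W_Ψ W_Ψ^* = Ψ, W_Φ W_Φ^* = Φ}`. -/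
noncomputable def hellingerDist (Φ Ψ : UnitTorus → Matrix (Fin m) (Fin m) ℂ) : ℝ≥0∞ :=
  sInf {d | ∃ WΨ WΦ : UnitTorus → Matrix (Fin m) (Fin m) ℂ,
    IsSpectralFactor WΨ Ψ ∧ IsSpectralFactor WΦ Φ ∧ d = matrixL2Norm (WΨ - WΦ)}

/-- The `L_∞^{m×m}` norm: the essential supremum over the circle of the spectral norm
(the operator norm on Euclidean space) of the values. -/
noncomputable def matrixLinftyNorm (V : UnitTorus → Matrix (Fin m) (Fin m) ℂ) : ℝ≥0∞ :=
  essSup (fun θ => ‖Matrix.toEuclideanCLM (n := Fin m) (𝕜 := ℂ) (V θ)‖ₑ) torusMeasure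

end Spectra

section Approximation

variable {n m : ℕ}

/-- The feasible set of the moment problem: the `Φ ∈ S_+^{m×m}(𝕋)` with `∫ G Φ G^* = S`. -/
def feasibleSpectra (A : Matrix (Fin n) (Fin n) ℂ) (B : Matrix (Fin n) (Fin m) ℂ)
    (S : Matrix (Fin n) (Fin n) ℂ) : Set (UnitTorus → Matrix (Fin m) (Fin m) ℂ) :=
  {Φ | IsSpectralDensity Φ ∧ stateCovariance A B Φ = S}

/-- `Φ` solves the Hellinger approximation problem with prior `Ψ` and covariance `S`:
it minimizes `d_H(·, Ψ)` over the feasible spectra. -/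
def IsHellingerOptimal (A : Matrix (Fin n) (Fin n) ℂ) (B : Matrix (Fin n) (Fin m) ℂ)
    (Ψ : UnitTorus → Matrix (Fin m) (Fin m) ℂ) (S : Matrix (Fin n) (Fin n) ℂ)
    (Φ : UnitTorus → Matrix (Fin m) (Fin m) ℂ) : Prop :=
  Φ ∈ feasibleSpectra A B S ∧
  ∀ Φ' ∈ feasibleSpectra A B S, hellingerDist Φ Ψ ≤ hellingerDist Φ' Ψ

open Classical in
/-- The Hellinger optimal spectrum `Φ_opt^H(S)`: a solution of the approximation problem
(with the value `0` where the problem has no solution). -/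
noncomputable def hellingerOpt (A : Matrix (Fin n) (Fin n) ℂ) (B : Matrix (Fin n) (Fin m) ℂ)
    (Ψ : UnitTorus → Matrix (Fin m) (Fin m) ℂ) (S : Matrix (Fin n) (Fin n) ℂ) :
    UnitTorus → Matrix (Fin m) (Fin m) ℂ :=
  if h : ∃ Φ, IsHellingerOptimal A B Ψ S Φ then h.choose else 0

end Approximation

/-! The proof is convex duality with a finite-dimensional multiplier. Put `Δ = 1 + G^* (Λ + Λ^*) G`
and suppose that `Δ` is positive definite on the circle. Completing the square
(`frobeniusSq_sub_eq`) writes `‖W_Ψ - W_Φ‖₂²` as a quantity depending on `Φ` only through `∫ G Φ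
G^*`, plus the integral of the trace of `(W_Φ - Δ⁻¹ W_Ψ)^* Δ (W_Φ - Δ⁻¹ W_Ψ)`. Hence, if `Δ⁻¹ Ψ Δ⁻¹`
has covariance `S`, it is the optimum, and the unique one by coercivity of `Δ`. That moment
condition is the stationarity of the dual functional `J_S(Λ) = Re ∫ tr (Δ⁻¹ Ψ) + Re tr ((Λ + Λ^*)
S)` (`IsDualCritical.isHellingerOptimal`).

A stationary point exists because `J_S` attains its minimum (`exists_isDualCritical`). Since `S` is
the covariance of a coercive spectrum (`exists_posDef_spectrum`, a maximum entropy construction), a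
bound on `J_S` bounds both `∫ tr Δ` and `∫ tr Δ⁻¹`. The first bound keeps `Λ` in a compact set, once
directions invisible to `Δ` are removed. The second keeps `Δ` from degenerating: `Δ` is twice
differentiable in the angle, so a zero of one of its nonnegative quadratic forms has order at least
two, and `∫ tr Δ⁻¹` would diverge (`mem_dualDomain_of_mem_closure`).

For continuity, an exact difference formula (`IsDualCritical.dualFunctional_sub`) makes a stationary
point a strict minimum. Moving `S` changes only the linear term of `J_S`, so a stationary point
survives in any prescribed small ball (`IsDualCritical.exists_near`). Then `Δ`, `Δ⁻¹` and `Δ⁻¹ Ψ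
Δ⁻¹` move little in the uniform norm. Strong consistency is this deterministic continuity applied to
almost every sample path. -/

/-! ### The resolvent on the unit circle and Lyapunov uniqueness -/

section Resolvent

open scoped Matrix.Norms.L2Operator

variable {n m : ℕ}

/-- The resolvent `(z I - A)⁻¹` at the point `z = e^{iϑ}` of the unit circle. -/
noncomputable def circleResolvent (A : Matrix (Fin n) (Fin n) ℂ) (θ : UnitTorus) :
    Matrix (Fin n) (Fin n) ℂ :=
  ((AddCircle.toCircle θ : ℂ) • (1 : Matrix (Fin n) (Fin n) ℂ) - A)⁻¹

theorem transferFunction_eq (A : Matrix (Fin n) (Fin n) ℂ) (B : Matrix (Fin n) (Fin m) ℂ)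
    (θ : UnitTorus) : transferFunction A B θ = circleResolvent A θ * B := rfl

theorem continuous_coe_toCircle : Continuous fun θ : UnitTorus => (AddCircle.toCircle θ : ℂ) :=
  continuous_subtype_val.comp AddCircle.continuous_toCircle

theorem Continuous.integrable_torus {E : Type*} [NormedAddCommGroup E]
    {f : UnitTorus → E} (hf : Continuous f) : Integrable f torusMeasure :=
  hf.integrable_of_hasCompactSupport (HasCompactSupport.of_compactSpace f)

/-- By Gelfand's formula `‖A ^ k‖ ^ (1 / k)` tends to the spectral radius, so `‖A ^ k‖ ≤ r ^ k`
eventually for some fixed `r < 1`. -/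
theorem IsStabilityMatrix.tendsto_pow {A : Matrix (Fin n) (Fin n) ℂ} (hA : IsStabilityMatrix A) :
    Tendsto (fun k => A ^ k) atTop (𝓝 0) := by
  rcases subsingleton_or_nontrivial (Matrix (Fin n) (Fin n) ℂ) with h | h
  · have : (fun k => A ^ k) = fun _ => 0 := by
      funext k; exact Subsingleton.elim _ _
    rw [this]; exact tendsto_const_nhds
  have h1 : spectralRadius ℂ A < (1 : NNReal) :=
    spectrum.spectralRadius_lt_of_forall_lt A fun z hz => by
      have := hA z hz
      exact_mod_cast this
  obtain ⟨r, hr1, hr2⟩ := ENNReal.lt_iff_exists_nnreal_btwn.mp h1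
  have hr3 : r < 1 := by exact_mod_cast hr2
  have h2 := spectrum.pow_nnnorm_pow_one_div_tendsto_nhds_spectralRadius A
  have h3 := h2.eventually (gt_mem_nhds hr1)
  rw [tendsto_zero_iff_norm_tendsto_zero]
  have h4 : Tendsto (fun k : ℕ => (r : ℝ) ^ k) atTop (𝓝 0) :=
    tendsto_pow_atTop_nhds_zero_of_lt_one r.2 (by exact_mod_cast hr3)
  refine squeeze_zero' (Eventually.of_forall fun _ => norm_nonneg _) ?_ h4
  filter_upwards [h3, eventually_gt_atTop 0] with k hk hk0
  have hk' : (0 : ℝ) < k := by exact_mod_cast hk0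
  have h5 := (ENNReal.rpow_lt_rpow hk hk')
  rw [← ENNReal.rpow_mul, one_div, inv_mul_cancel₀ hk'.ne', ENNReal.rpow_one,
    ENNReal.rpow_natCast] at h5
  have h6 : ‖A ^ k‖₊ < r ^ k := by exact_mod_cast h5
  exact_mod_cast h6.le

theorem IsStabilityMatrix.isUnit_sub {A : Matrix (Fin n) (Fin n) ℂ} (hA : IsStabilityMatrix A)
    (θ : UnitTorus) :
    IsUnit ((AddCircle.toCircle θ : ℂ) • (1 : Matrix (Fin n) (Fin n) ℂ) - A) := by
  by_contra h
  have h1 : (AddCircle.toCircle θ : ℂ) ∈ spectrum ℂ A := by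
    rw [spectrum.mem_iff, Algebra.algebraMap_eq_smul_one]; exact h
  have h2 := hA _ h1
  rw [Circle.norm_coe] at h2
  exact lt_irrefl _ h2

theorem IsStabilityMatrix.continuous_circleResolvent {A : Matrix (Fin n) (Fin n) ℂ}
    (hA : IsStabilityMatrix A) : Continuous (circleResolvent A) := by
  rw [continuous_iff_continuousAt]
  intro θ
  have h1 : ContinuousAt Ring.inverse
      ((AddCircle.toCircle θ : ℂ) • (1 : Matrix (Fin n) (Fin n) ℂ) - A) := by
    obtain ⟨u, hu⟩ := hA.isUnit_sub θ
    rw [← hu]; exact NormedRing.inverse_continuousAt u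
  have h2 : Continuous fun θ : UnitTorus =>
      (AddCircle.toCircle θ : ℂ) • (1 : Matrix (Fin n) (Fin n) ℂ) - A :=
    (continuous_coe_toCircle.smul continuous_const).sub continuous_const
  have h3 := ContinuousAt.comp (f := fun θ : UnitTorus =>
      (AddCircle.toCircle θ : ℂ) • (1 : Matrix (Fin n) (Fin n) ℂ) - A) h1 h2.continuousAt
  refine h3.congr (Eventually.of_forall fun θ => ?_)
  exact (Matrix.nonsing_inv_eq_ringInverse _).symm

theorem IsStabilityMatrix.continuous_transferFunction {A : Matrix (Fin n) (Fin n) ℂ}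
    (hA : IsStabilityMatrix A) (B : Matrix (Fin n) (Fin m) ℂ) :
    Continuous (transferFunction A B) :=
  hA.continuous_circleResolvent.matrix_mul continuous_const

theorem IsStabilityMatrix.smul_circleResolvent {A : Matrix (Fin n) (Fin n) ℂ}
    (hA : IsStabilityMatrix A) (θ : UnitTorus) :
    (AddCircle.toCircle θ : ℂ) • circleResolvent A θ = A * circleResolvent A θ + 1 := by
  have h := Matrix.mul_nonsing_inv _ ((Matrix.isUnit_iff_isUnit_det _).mp (hA.isUnit_sub θ))
  rw [Matrix.sub_mul, Matrix.smul_mul, Matrix.one_mul] at h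
  rw [← h]; simp [circleResolvent]

/-- Integrating `z R = A R + 1` against `z ^ (-(k + 1))` shifts the Fourier index of the resolvent
`R` at the price of a factor `A`. Iterating, `∫ R = A ^ k ∫ z ^ (-k) R`, which tends to zero since
the last integral is bounded by `∫ ‖R‖`. -/
theorem IsStabilityMatrix.integral_circleResolvent {A : Matrix (Fin n) (Fin n) ℂ}
    (hA : IsStabilityMatrix A) : ∫ θ, circleResolvent A θ ∂torusMeasure = 0 := by
  have hc := hA.continuous_circleResolvent
  have hcf : ∀ k : ℤ, Continuous fun θ : UnitTorus => fourier k θ • circleResolvent A θ :=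
    fun k => (fourier k).continuous.smul hc
  have hstep : ∀ k : ℕ, ∫ θ : UnitTorus, fourier (-(k : ℤ)) θ • circleResolvent A θ ∂torusMeasure =
      A * ∫ θ : UnitTorus, fourier (-((k + 1 : ℕ) : ℤ)) θ • circleResolvent A θ ∂torusMeasure := by
    intro k
    have h0 : ∫ θ : UnitTorus, fourier (-((k + 1 : ℕ) : ℤ)) θ ∂torusMeasure = 0 :=
      integral_eq_zero_of_add_right_eq_neg (μ := AddCircle.haarAddCircle)
        (fourier_add_half_inv_index (by omega) Real.two_pi_pos)
    have h1 : ∀ θ : UnitTorus, fourier (-(k : ℤ)) θ • circleResolvent A θ =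
        A * (fourier (-((k + 1 : ℕ) : ℤ)) θ • circleResolvent A θ) +
          (fourier (-((k + 1 : ℕ) : ℤ)) θ) • 1 := by
      intro θ
      have h2 : (fourier (-(k : ℤ)) θ : ℂ) =
          fourier (-((k + 1 : ℕ) : ℤ)) θ * AddCircle.toCircle θ := by
        have h3 : (-(k : ℤ)) = -((k + 1 : ℕ) : ℤ) + 1 := by push_cast; ring
        rw [← fourier_one (x := θ), ← fourier_add, h3]
      rw [h2, mul_smul, hA.smul_circleResolvent, smul_add, Matrix.mul_smul]
    simp_rw [h1]
    have i1 : Integrable (fun θ : UnitTorus =>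
        A * (fourier (-((k + 1 : ℕ) : ℤ)) θ • circleResolvent A θ)) torusMeasure :=
      (continuous_const.mul (hcf _)).integrable_torus
    have i2 : Integrable (fun θ : UnitTorus =>
        (fourier (-((k + 1 : ℕ) : ℤ)) θ : ℂ) • (1 : Matrix (Fin n) (Fin n) ℂ)) torusMeasure :=
      ((fourier _).continuous.smul continuous_const).integrable_torus
    rw [integral_add i1 i2, integral_smul_const, h0, zero_smul, add_zero,
      integral_const_mul_of_integrable (hcf _).integrable_torus]
  have hpow : ∀ k : ℕ, ∫ θ : UnitTorus, circleResolvent A θ ∂torusMeasure =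
      A ^ k * ∫ θ : UnitTorus, fourier (-(k : ℤ)) θ • circleResolvent A θ ∂torusMeasure := by
    intro k
    induction k with
    | zero => simp
    | succ k ih => rw [ih, hstep k, pow_succ, mul_assoc]
  have hb : ∀ k : ℕ, ‖∫ θ : UnitTorus, circleResolvent A θ ∂torusMeasure‖ ≤
      ‖A ^ k‖ * ∫ θ : UnitTorus, ‖circleResolvent A θ‖ ∂torusMeasure := by
    intro k
    rw [hpow k]
    refine (norm_mul_le _ _).trans ?_
    gcongr
    refine (norm_integral_le_integral_norm _).trans (le_of_eq ?_)
    congr 1; funext θ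
    rw [norm_smul, fourier_apply, Circle.norm_coe, one_mul]
  have ht : Tendsto (fun k : ℕ => ‖A ^ k‖ * ∫ θ : UnitTorus, ‖circleResolvent A θ‖ ∂torusMeasure)
      atTop (𝓝 (0 * ∫ θ : UnitTorus, ‖circleResolvent A θ‖ ∂torusMeasure)) :=
    ((tendsto_zero_iff_norm_tendsto_zero.mp hA.tendsto_pow)).mul_const _
  rw [zero_mul] at ht
  exact norm_le_zero_iff.mp (ge_of_tendsto' ht hb)

/-- Iteration gives `D = A ^ k D (A ^ k)^*`, which tends to zero. This is the uniqueness half of the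
Lyapunov equation. -/
theorem IsStabilityMatrix.eq_zero_of_eq_conj {A D : Matrix (Fin n) (Fin n) ℂ}
    (hA : IsStabilityMatrix A) (hD : D = A * D * Aᴴ) : D = 0 := by
  have h : ∀ k : ℕ, D = A ^ k * D * (A ^ k)ᴴ := by
    intro k
    induction k with
    | zero => simp
    | succ k ih =>
      conv_lhs => rw [ih, hD]
      simp only [pow_succ, Matrix.conjTranspose_mul, Matrix.mul_assoc]
  have h1 : Tendsto (fun k => A ^ k * D * (A ^ k)ᴴ) atTop (𝓝 (0 * D * 0ᴴ)) :=
    (hA.tendsto_pow.mul_const D).mul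
      ((continuous_id.matrix_conjTranspose.tendsto _).comp hA.tendsto_pow)
  simp_rw [← h] at h1
  simpa using tendsto_nhds_unique tendsto_const_nhds h1

/-- Matrix entries as a continuous linear functional. -/
noncomputable def entryCLM (i : Fin n) (j : Fin m) : Matrix (Fin n) (Fin m) ℂ →L[ℂ] ℂ :=
  LinearMap.toContinuousLinearMap (Matrix.entryLinearMap ℂ ℂ i j)

theorem integral_matrix_apply {X : Type*} [MeasurableSpace X] {μ : Measure X}
    {F : X → Matrix (Fin n) (Fin m) ℂ} (hF : Integrable F μ) (i : Fin n) (j : Fin m) :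
    (∫ θ, F θ ∂μ) i j = ∫ θ, F θ i j ∂μ :=
  ((entryCLM i j).integral_comp_comm hF).symm

theorem stateCovariance_eq_integral {A : Matrix (Fin n) (Fin n) ℂ} {B : Matrix (Fin n) (Fin m) ℂ}
    {Φ : UnitTorus → Matrix (Fin m) (Fin m) ℂ}
    (h : Integrable (fun θ => transferFunction A B θ * Φ θ * (transferFunction A B θ)ᴴ)
      torusMeasure) :
    stateCovariance A B Φ =
      ∫ θ, transferFunction A B θ * Φ θ * (transferFunction A B θ)ᴴ ∂torusMeasure := by
  ext i j
  rw [integral_matrix_apply h]; rfl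

theorem integral_conjTranspose {X : Type*} [MeasurableSpace X] {μ : Measure X}
    {F : X → Matrix (Fin n) (Fin m) ℂ} (hF : Integrable F μ) :
    ∫ θ, (F θ)ᴴ ∂μ = (∫ θ, F θ ∂μ)ᴴ := by
  have hF' : Integrable (fun θ => (F θ)ᴴ) μ :=
    ⟨continuous_id.matrix_conjTranspose.comp_aestronglyMeasurable hF.1,
      hF.2.congr' (Eventually.of_forall fun θ => (Matrix.l2_opNorm_conjTranspose _).symm)⟩
  ext i j
  rw [integral_matrix_apply hF', Matrix.conjTranspose_apply, integral_matrix_apply hF]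
  exact integral_conj

theorem integral_mul_mul {X : Type*} [MeasurableSpace X] {μ : Measure X}
    {F : X → Matrix (Fin n) (Fin n) ℂ} (hF : Integrable F μ) (P Q : Matrix (Fin n) (Fin n) ℂ) :
    ∫ θ, P * F θ * Q ∂μ = P * (∫ θ, F θ ∂μ) * Q := by
  rw [integral_mul_const_of_integrable (hF.const_mul P), integral_const_mul_of_integrable hF]

end Resolvent

/-! ### A coercive spectrum with prescribed covariance -/

section MaximumEntropy

open scoped Matrix.Norms.L2Operator

variable {n m : ℕ}

theorem mulVec_injective_of_rank_eq {B : Matrix (Fin n) (Fin m) ℂ} (hB : B.rank = m) :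
    Function.Injective B.mulVec := by
  have h := LinearMap.finrank_range_add_finrank_ker B.mulVecLin
  have h1 : Module.finrank ℂ (LinearMap.range B.mulVecLin) = m := hB
  rw [h1, Module.finrank_fin_fun] at h
  have h2 : LinearMap.ker B.mulVecLin = ⊥ := by
    apply Submodule.finrank_eq_zero.mp; omega
  exact LinearMap.ker_eq_bot.mp h2

/-- The Popov–Belevitch–Hautus test: a left eigenvector of `A` that annihilates `B` annihilates
every `A ^ k B`, and these columns span. -/
theorem IsReachablePair.eq_zero_of_vecMul {A : Matrix (Fin n) (Fin n) ℂ}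
    {B : Matrix (Fin n) (Fin m) ℂ} (hAB : IsReachablePair A B) {w : Fin n → ℂ} {c : ℂ}
    (hw : w ᵥ* A = c • w) (hwB : w ᵥ* B = 0) : w = 0 := by
  have hpow : ∀ k : ℕ, w ᵥ* A ^ k = c ^ k • w := by
    intro k
    induction k with
    | zero => simp
    | succ k ih => rw [pow_succ, ← Matrix.vecMul_vecMul, ih, Matrix.smul_vecMul, hw, smul_smul,
        pow_succ]
  have h : ∀ v : Fin n → ℂ, w ⬝ᵥ v = 0 := by
    intro v
    have hv : v ∈ Submodule.span ℂ
        {v : Fin n → ℂ | ∃ k < n, ∃ j : Fin m, v = (A ^ k * B).col j} := by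
      rw [hAB]; trivial
    induction hv using Submodule.span_induction with
    | mem x hx =>
      obtain ⟨k, -, j, rfl⟩ := hx
      have h1 : w ᵥ* (A ^ k * B) = 0 := by
        rw [← Matrix.vecMul_vecMul, hpow, Matrix.smul_vecMul, hwB, smul_zero]
      exact congrFun h1 j
    | zero => simp
    | add x y _ _ hx hy => rw [dotProduct_add, hx, hy, add_zero]
    | smul a x _ hx => rw [dotProduct_smul, hx, smul_zero]
  exact dotProduct_eq_zero w h

theorem exists_left_eigenvector {A : Matrix (Fin n) (Fin n) ℂ} {c : ℂ} (hc : c ∈ spectrum ℂ A) :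
    ∃ w : Fin n → ℂ, w ≠ 0 ∧ w ᵥ* A = c • w := by
  rw [spectrum.mem_iff, Algebra.algebraMap_eq_smul_one, Matrix.isUnit_iff_isUnit_det,
    isUnit_iff_ne_zero, not_not] at hc
  obtain ⟨w, hw, h⟩ := Matrix.exists_vecMul_eq_zero_iff.mpr hc
  refine ⟨w, hw, ?_⟩
  rw [Matrix.vecMul_sub, Matrix.vecMul_smul, Matrix.vecMul_one] at h
  exact (sub_eq_zero.mp h).symm

/-- Lyapunov's criterion: closed-loop stability from a positive definite solution. -/
theorem IsReachablePair.isStabilityMatrix_of_lyapunov {A : Matrix (Fin n) (Fin n) ℂ}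
    {B : Matrix (Fin n) (Fin m) ℂ} (hAB : IsReachablePair A B) {S : Matrix (Fin n) (Fin n) ℂ}
    (hS : S.PosDef) {M : Matrix (Fin m) (Fin m) ℂ} (hM : M.PosDef) (K : Matrix (Fin m) (Fin n) ℂ)
    (h : S = (A - B * K) * S * (A - B * K)ᴴ + B * M * Bᴴ) : IsStabilityMatrix (A - B * K) := by
  intro c hc
  obtain ⟨w, hw, hwc⟩ := exists_left_eigenvector hc
  by_contra hlt
  push Not at hlt
  have hSw : 0 < (w ⬝ᵥ S *ᵥ star w) := by
    have := hS.dotProduct_mulVec_pos (x := star w) (by simpa using hw)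
    simpa using this
  set q := star (w ᵥ* B) with hq
  have hq' : Bᴴ *ᵥ star w = q := by rw [hq, Matrix.star_vecMul]
  have hMw : 0 ≤ w ᵥ* B ⬝ᵥ M *ᵥ q := by
    have := hM.posSemidef.dotProduct_mulVec_nonneg q
    simpa [hq] using this
  have hcl : (A - B * K)ᴴ *ᵥ star w = star c • star w := by
    rw [← Matrix.star_vecMul, hwc, star_smul]
  -- The Lyapunov equation evaluated on a left eigenvector: `(1 - |c|²) w S w^* = w B M B^* w^*`. If
  -- `|c| ≥ 1` the left side is at most zero, so `w B = 0`. Then feedback is invisible to `w`, which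
  -- is a left eigenvector of `A` itself.
  have hid : w ⬝ᵥ S *ᵥ star w = (c * star c) * (w ⬝ᵥ S *ᵥ star w) + w ᵥ* B ⬝ᵥ M *ᵥ q := by
    conv_lhs => rw [h]
    rw [Matrix.add_mulVec, dotProduct_add, ← Matrix.mulVec_mulVec, ← Matrix.mulVec_mulVec,
      ← Matrix.mulVec_mulVec, ← Matrix.mulVec_mulVec, hcl, hq', Matrix.dotProduct_mulVec w B,
      Matrix.dotProduct_mulVec w (A - B * K), hwc]
    simp only [Matrix.mulVec_smul, dotProduct_smul, smul_dotProduct, smul_eq_mul]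
    ring
  have hcc : c * star c = ((‖c‖ ^ 2 : ℝ) : ℂ) := by
    rw [Complex.star_def, Complex.mul_conj, Complex.normSq_eq_norm_sq]
  have hc1 : (1 : ℂ) ≤ c * star c := by
    rw [hcc]; exact_mod_cast one_le_pow₀ hlt
  have hle : w ᵥ* B ⬝ᵥ M *ᵥ q ≤ 0 := by
    have h1 : w ᵥ* B ⬝ᵥ M *ᵥ q = -((c * star c - 1) * (w ⬝ᵥ S *ᵥ star w)) := by
      linear_combination -hid
    rw [h1, neg_nonpos]
    exact mul_nonneg (sub_nonneg.mpr hc1) hSw.le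
  have hzero : w ᵥ* B = 0 := by
    by_contra hne
    have := hM.dotProduct_mulVec_pos (x := q) (by simpa [hq] using hne)
    rw [hq, star_star, ← hq] at this
    exact absurd (lt_of_lt_of_le this hle) (lt_irrefl _)
  refine hw (hAB.eq_zero_of_vecMul (c := c) ?_ hzero)
  rw [← hwc, Matrix.vecMul_sub, ← Matrix.vecMul_vecMul, hzero, Matrix.zero_vecMul, sub_zero]

/-- Expanding `R Q R^* = (z R) Q (z R)^*` with `z R = A R + 1` shows that the integral solves the
same Lyapunov equation as `S`, the cross terms vanishing because `∫ R = 0`. Uniqueness of the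
solution concludes. -/
theorem IsStabilityMatrix.integral_resolvent_lyapunov {A : Matrix (Fin n) (Fin n) ℂ}
    (hA : IsStabilityMatrix A) {S Q : Matrix (Fin n) (Fin n) ℂ} (h : S = A * S * Aᴴ + Q) :
    ∫ θ, circleResolvent A θ * Q * (circleResolvent A θ)ᴴ ∂torusMeasure = S := by
  have hc := hA.continuous_circleResolvent
  have hcH := hc.matrix_conjTranspose
  set R := circleResolvent A with hR
  have hRQ : Continuous fun θ => R θ * Q * (R θ)ᴴ := (hc.mul continuous_const).mul hcH
  set X := ∫ θ, R θ * Q * (R θ)ᴴ ∂torusMeasure with hX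
  have hpt : ∀ θ, R θ * Q * (R θ)ᴴ = (A * (R θ * Q * (R θ)ᴴ) * Aᴴ + A * R θ * Q) +
      (Q * (R θ)ᴴ * Aᴴ + Q) := by
    intro θ
    have h1 := hA.smul_circleResolvent θ
    have h2 : (AddCircle.toCircle θ : ℂ) * star (AddCircle.toCircle θ : ℂ) = 1 := by
      rw [Complex.star_def, Complex.mul_conj, Circle.normSq_coe, Complex.ofReal_one]
    calc R θ * Q * (R θ)ᴴ = ((AddCircle.toCircle θ : ℂ) * star (AddCircle.toCircle θ : ℂ)) •
          (R θ * Q * (R θ)ᴴ) := by rw [h2, one_smul]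
      _ = ((AddCircle.toCircle θ : ℂ) • R θ) * Q * ((AddCircle.toCircle θ : ℂ) • R θ)ᴴ := by
          rw [Matrix.conjTranspose_smul, Matrix.smul_mul, Matrix.smul_mul, Matrix.mul_smul,
            smul_smul]
      _ = _ := by
          rw [h1, Matrix.conjTranspose_add, Matrix.conjTranspose_mul, Matrix.conjTranspose_one]
          noncomm_ring
  have hi1 : ∫ θ, A * R θ * Q ∂torusMeasure = 0 := by
    rw [integral_mul_mul hc.integrable_torus, hA.integral_circleResolvent]; simp
  have hi2 : ∫ θ, Q * (R θ)ᴴ * Aᴴ ∂torusMeasure = 0 := by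
    rw [integral_mul_mul hcH.integrable_torus, integral_conjTranspose hc.integrable_torus,
      hA.integral_circleResolvent]; simp
  have hXeq : X = A * X * Aᴴ + Q := by
    conv_lhs => rw [hX, funext hpt]
    have c1 : Continuous fun θ => A * (R θ * Q * (R θ)ᴴ) * Aᴴ :=
      (continuous_const.mul hRQ).mul continuous_const
    have c2 : Continuous fun θ => A * R θ * Q := (continuous_const.mul hc).mul continuous_const
    have c3 : Continuous fun θ => Q * (R θ)ᴴ * Aᴴ :=
      (continuous_const.mul hcH).mul continuous_const
    have c4 : Continuous fun _ : UnitTorus => Q := continuous_const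
    have c12 : Continuous fun θ => A * (R θ * Q * (R θ)ᴴ) * Aᴴ + A * R θ * Q := c1.add c2
    have c34 : Continuous fun θ => Q * (R θ)ᴴ * Aᴴ + Q := c3.add c4
    rw [integral_add c12.integrable_torus c34.integrable_torus,
      integral_add c1.integrable_torus c2.integrable_torus,
      integral_add c3.integrable_torus c4.integrable_torus, hi1, hi2,
      integral_mul_mul hRQ.integrable_torus]
    simp [hX]
  have hD : X - S = A * (X - S) * Aᴴ := by
    conv_lhs => rw [hXeq, h]
    noncomm_ring
  exact sub_eq_zero.mp (hA.eq_zero_of_eq_conj hD)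

/-- Every `S ∈ P_Γ` is the state covariance of a continuous positive definite spectrum. -/
theorem exists_posDef_spectrum {A : Matrix (Fin n) (Fin n) ℂ}
    {B : Matrix (Fin n) (Fin m) ℂ} (hA : IsStabilityMatrix A) (hB : B.rank = m)
    (hAB : IsReachablePair A B) {S : Matrix (Fin n) (Fin n) ℂ} (hS : S ∈ PGamma A B) :
    ∃ Φ : UnitTorus → Matrix (Fin m) (Fin m) ℂ, Continuous Φ ∧ (∀ θ, (Φ θ).PosDef) ∧
      stateCovariance A B Φ = S := by
  obtain ⟨⟨Φ₀, hΦc, -, hΦS⟩, hSpos⟩ := hS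
  have hN : (Bᴴ * S⁻¹ * B).PosDef :=
    hSpos.inv.conjTranspose_mul_mul_same (mulVec_injective_of_rank_eq hB)
  have hSu : IsUnit S.det := (Matrix.isUnit_iff_isUnit_det _).mp hSpos.isUnit
  have hNu : IsUnit (Bᴴ * S⁻¹ * B).det := (Matrix.isUnit_iff_isUnit_det _).mp hN.isUnit
  set M := (Bᴴ * S⁻¹ * B)⁻¹ with hM
  have hMpos : M.PosDef := hN.inv
  have hMH : Mᴴ = M := hMpos.isHermitian
  have hSiH : (S⁻¹)ᴴ = S⁻¹ := hSpos.inv.isHermitian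
  have hMN : M * (Bᴴ * S⁻¹ * B) = 1 := Matrix.nonsing_inv_mul _ hNu
  -- The projection with kernel the range of `B`, orthogonal for the inner product given by `S⁻¹`;
  -- `M` is the normalization that makes `P * B = 0`.
  set P := 1 - B * M * Bᴴ * S⁻¹ with hP
  have hPB : P * B = 0 := by
    have : B * M * Bᴴ * S⁻¹ * B = B * (M * (Bᴴ * S⁻¹ * B)) := by simp only [Matrix.mul_assoc]
    rw [hP, Matrix.sub_mul, this, hMN]; simp
  have hPSP : P * S * Pᴴ = S - B * M * Bᴴ := by
    have h1 : P * S = S - B * M * Bᴴ := by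
      rw [hP, Matrix.sub_mul, Matrix.mul_assoc _ S⁻¹ S, Matrix.nonsing_inv_mul _ hSu]; simp
    have h2 : Pᴴ = 1 - S⁻¹ * B * M * Bᴴ := by
      rw [hP, Matrix.conjTranspose_sub, Matrix.conjTranspose_one]
      simp only [Matrix.conjTranspose_mul, Matrix.conjTranspose_conjTranspose, hMH, hSiH,
        Matrix.mul_assoc]
    have h3 : P * S * (S⁻¹ * B * M * Bᴴ) = 0 := by
      calc P * S * (S⁻¹ * B * M * Bᴴ) = P * (S * S⁻¹) * B * M * Bᴴ := by
            simp only [Matrix.mul_assoc]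
        _ = 0 := by rw [Matrix.mul_nonsing_inv _ hSu, Matrix.mul_one, hPB]; simp
    rw [h2, Matrix.mul_sub, h3, h1]; simp
  have hGc := hA.continuous_transferFunction B
  set G := transferFunction A B with hG
  have hGGc : Continuous fun θ => G θ * Φ₀ θ * (G θ)ᴴ :=
    (hGc.matrix_mul hΦc).matrix_mul hGc.matrix_conjTranspose
  have hSint : ∫ θ, G θ * Φ₀ θ * (G θ)ᴴ ∂torusMeasure = S := by
    rw [← stateCovariance_eq_integral hGGc.integrable_torus, hΦS]
  have hPG : ∀ θ, (AddCircle.toCircle θ : ℂ) • (P * G θ) = P * A * G θ := by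
    intro θ
    have h1 := hA.smul_circleResolvent θ
    rw [hG, transferFunction_eq, ← Matrix.mul_smul, ← Matrix.smul_mul, h1, Matrix.add_mul,
      Matrix.mul_add, Matrix.one_mul, hPB, add_zero]
    simp only [Matrix.mul_assoc]
  -- The only place where this construction uses that `S` lies in the range of `Γ`. From `z G = A G
  -- + B` and `P B = 0` follows `z P G = P A G`, and the factor `z` of modulus one drops out of `P G
  -- Φ₀ G^* P^*`.
  have hPA : P * S * Pᴴ = (P * A) * S * (P * A)ᴴ := by
    rw [← hSint, ← integral_mul_mul hGGc.integrable_torus,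
      ← integral_mul_mul hGGc.integrable_torus]
    congr 1; funext θ
    have h2 : (AddCircle.toCircle θ : ℂ) * star (AddCircle.toCircle θ : ℂ) = 1 := by
      rw [Complex.star_def, Complex.mul_conj, Circle.normSq_coe, Complex.ofReal_one]
    calc P * (G θ * Φ₀ θ * (G θ)ᴴ) * Pᴴ
        = ((AddCircle.toCircle θ : ℂ) * star (AddCircle.toCircle θ : ℂ)) •
          ((P * G θ) * Φ₀ θ * (P * G θ)ᴴ) := by
          rw [h2, one_smul, Matrix.conjTranspose_mul]; simp only [Matrix.mul_assoc]
      _ = ((AddCircle.toCircle θ : ℂ) • (P * G θ)) * Φ₀ θ *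
          ((AddCircle.toCircle θ : ℂ) • (P * G θ))ᴴ := by
          rw [Matrix.conjTranspose_smul, Matrix.smul_mul, Matrix.smul_mul, Matrix.mul_smul,
            smul_smul]
      _ = _ := by
          rw [hPG, Matrix.conjTranspose_mul]; simp only [Matrix.mul_assoc]
  -- The feedback gain with `P A = A - B K`. The two expressions for `P S P^*` now combine into a
  -- Lyapunov equation for the closed loop.
  set K := M * Bᴴ * S⁻¹ * A with hK
  have hAc : P * A = A - B * K := by
    rw [hP, hK, Matrix.sub_mul, Matrix.one_mul]; simp only [Matrix.mul_assoc]
  have hlyap : S = (A - B * K) * S * (A - B * K)ᴴ + B * M * Bᴴ := by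
    rw [← hAc, ← hPA, hPSP, sub_add_cancel]
  have hstab := hAB.isStabilityMatrix_of_lyapunov hSpos hMpos K hlyap
  set Rc := circleResolvent (A - B * K) with hRc
  -- `W` is the inverse of `1 + K G`, and `G W` is the closed-loop transfer function. Thus `W M W^*`
  -- has covariance `∫ Rc (B M B^*) Rc^*`, which the Lyapunov equation identifies with `S`.
  set W : UnitTorus → Matrix (Fin m) (Fin m) ℂ := fun θ => 1 - K * Rc θ * B with hW
  have hRcc : Continuous Rc := hstab.continuous_circleResolvent
  have hWc : Continuous W :=
    continuous_const.sub ((continuous_const.matrix_mul hRcc).matrix_mul continuous_const)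
  have hinv : ∀ θ, circleResolvent A θ * (1 - B * K * Rc θ) = Rc θ := by
    intro θ
    have h1 := hstab.smul_circleResolvent θ
    rw [← hRc] at h1
    have h2 : 1 - B * K * Rc θ =
        ((AddCircle.toCircle θ : ℂ) • (1 : Matrix (Fin n) (Fin n) ℂ) - A) * Rc θ := by
      rw [Matrix.sub_mul, Matrix.smul_mul, Matrix.one_mul, h1]
      noncomm_ring
    rw [h2, ← Matrix.mul_assoc, circleResolvent,
      Matrix.nonsing_inv_mul _ ((Matrix.isUnit_iff_isUnit_det _).mp (hA.isUnit_sub θ)),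
      Matrix.one_mul]
  have hGW : ∀ θ, G θ * W θ = Rc θ * B := by
    intro θ
    rw [← hinv θ, hG, transferFunction_eq, hW]
    simp only [Matrix.mul_sub, Matrix.sub_mul, Matrix.mul_one, Matrix.mul_assoc]
  have hWinv : ∀ θ, (1 + K * G θ) * W θ = 1 := by
    intro θ
    rw [Matrix.add_mul, Matrix.one_mul, Matrix.mul_assoc, hGW, hW]
    simp only [Matrix.mul_assoc, sub_add_cancel]
  have hWpos : ∀ θ, (W θ * M * (W θ)ᴴ).PosDef := by
    intro θ
    refine hMpos.mul_mul_conjTranspose_same ?_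
    have h1 : W θ * (1 + K * G θ) = 1 := mul_eq_one_comm.mp (hWinv θ)
    intro x y hxy
    have h2 := congrArg (fun v => v ᵥ* (1 + K * G θ)) hxy
    simpa [Matrix.vecMul_vecMul, h1] using h2
  refine ⟨fun θ => W θ * M * (W θ)ᴴ,
    (hWc.matrix_mul continuous_const).matrix_mul hWc.matrix_conjTranspose, hWpos, ?_⟩
  have hpt : ∀ θ, G θ * (W θ * M * (W θ)ᴴ) * (G θ)ᴴ = Rc θ * (B * M * Bᴴ) * (Rc θ)ᴴ := by
    intro θ
    calc G θ * (W θ * M * (W θ)ᴴ) * (G θ)ᴴ = (G θ * W θ) * M * (G θ * W θ)ᴴ := by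
          rw [Matrix.conjTranspose_mul]; simp only [Matrix.mul_assoc]
      _ = _ := by rw [hGW, Matrix.conjTranspose_mul]; simp only [Matrix.mul_assoc]
  have hcont : Continuous fun θ => Rc θ * (B * M * Bᴴ) * (Rc θ)ᴴ :=
    (hRcc.mul continuous_const).mul hRcc.matrix_conjTranspose
  rw [stateCovariance_eq_integral (by simpa only [← hG, hpt] using hcont.integrable_torus)]
  simp only [← hG, hpt]
  exact hstab.integral_resolvent_lyapunov hlyap

end MaximumEntropy

/-! ### Trace and quadratic form estimates for positive matrices -/

section PositiveMatrices

open scoped Matrix.Norms.L2Operator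

variable {m : ℕ}

open scoped MatrixOrder in
theorem Matrix.PosSemidef.exists_eq_conjTranspose_mul_self {P : Matrix (Fin m) (Fin m) ℂ}
    (hP : P.PosSemidef) : ∃ C : Matrix (Fin m) (Fin m) ℂ, P = Cᴴ * C :=
  CStarAlgebra.nonneg_iff_eq_star_mul_self.mp hP.nonneg

theorem Matrix.PosSemidef.re_trace_nonneg {P : Matrix (Fin m) (Fin m) ℂ} (hP : P.PosSemidef) :
    0 ≤ P.trace.re :=
  (Complex.nonneg_iff.mp hP.trace_nonneg).1

theorem Matrix.PosSemidef.re_trace_mul_nonneg {P Q : Matrix (Fin m) (Fin m) ℂ}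
    (hP : P.PosSemidef) (hQ : Q.PosSemidef) : 0 ≤ (P * Q).trace.re := by
  obtain ⟨C, rfl⟩ := hP.exists_eq_conjTranspose_mul_self
  rw [Matrix.mul_assoc, Matrix.trace_mul_comm]
  exact (hQ.mul_mul_conjTranspose_same C).re_trace_nonneg

theorem Matrix.PosSemidef.mul_re_trace_le {P Q : Matrix (Fin m) (Fin m) ℂ} {c : ℝ}
    (hP : P.PosSemidef) (hQ : (Q - (c : ℂ) • (1 : Matrix (Fin m) (Fin m) ℂ)).PosSemidef) :
    c * P.trace.re ≤ (P * Q).trace.re := by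
  have h := hP.re_trace_mul_nonneg hQ
  rw [Matrix.mul_sub, Matrix.mul_smul, Matrix.mul_one, Matrix.trace_sub, Matrix.trace_smul,
    Complex.sub_re, smul_eq_mul, Complex.re_ofReal_mul] at h
  linarith

/-- The real quadratic form `v ↦ Re (v^* P v)`. -/
noncomputable def quadForm (P : Matrix (Fin m) (Fin m) ℂ) (v : Fin m → ℂ) : ℝ :=
  (star v ⬝ᵥ P *ᵥ v).re

theorem quadForm_add (P Q : Matrix (Fin m) (Fin m) ℂ) (v : Fin m → ℂ) :
    quadForm (P + Q) v = quadForm P v + quadForm Q v := by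
  simp [quadForm, Matrix.add_mulVec]

theorem quadForm_sub (P Q : Matrix (Fin m) (Fin m) ℂ) (v : Fin m → ℂ) :
    quadForm (P - Q) v = quadForm P v - quadForm Q v := by
  simp [quadForm, Matrix.sub_mulVec]

theorem quadForm_smul_one (c : ℝ) (v : Fin m → ℂ) :
    quadForm ((c : ℂ) • (1 : Matrix (Fin m) (Fin m) ℂ)) v = c * (star v ⬝ᵥ v).re := by
  simp [quadForm, Matrix.smul_mulVec]

theorem re_star_dotProduct_self (v : Fin m → ℂ) :
    (star v ⬝ᵥ v).re = ‖WithLp.toLp 2 v‖ ^ 2 := by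
  rw [EuclideanSpace.norm_sq_eq, dotProduct, Complex.re_sum]
  refine Finset.sum_congr rfl fun i _ => ?_
  rw [Pi.star_apply, Complex.star_def, mul_comm, Complex.mul_conj, Complex.normSq_eq_norm_sq,
    Complex.ofReal_re]

theorem re_star_dotProduct_self_pos {v : Fin m → ℂ} (hv : v ≠ 0) : 0 < (star v ⬝ᵥ v).re := by
  rw [re_star_dotProduct_self]
  have : WithLp.toLp 2 v ≠ 0 := by simpa using hv
  positivity

theorem abs_quadForm_le (P : Matrix (Fin m) (Fin m) ℂ) (v : Fin m → ℂ) :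
    |quadForm P v| ≤ ‖P‖ * (star v ⬝ᵥ v).re := by
  have h1 : star v ⬝ᵥ P *ᵥ v = inner ℂ (WithLp.toLp 2 v) (WithLp.toLp 2 (P *ᵥ v)) := by
    rw [EuclideanSpace.inner_eq_star_dotProduct, dotProduct_comm]
  rw [quadForm, h1, re_star_dotProduct_self]
  refine (Complex.abs_re_le_norm _).trans ((norm_inner_le_norm _ _).trans ?_)
  have h2 : ‖WithLp.toLp 2 (P *ᵥ v)‖ ≤ ‖P‖ * ‖WithLp.toLp 2 v‖ :=
    Matrix.l2_opNorm_mulVec P (WithLp.toLp 2 v)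
  nlinarith [norm_nonneg (WithLp.toLp 2 v)]

theorem Matrix.IsHermitian.posSemidef_of_quadForm {P : Matrix (Fin m) (Fin m) ℂ}
    (hP : P.IsHermitian) (h : ∀ v, 0 ≤ quadForm P v) : P.PosSemidef := by
  refine Matrix.PosSemidef.of_dotProduct_mulVec_nonneg hP fun v => ?_
  rw [Complex.nonneg_iff]
  exact ⟨h v, (hP.im_star_dotProduct_mulVec_self v).symm⟩

theorem Matrix.IsHermitian.posDef_of_quadForm {P : Matrix (Fin m) (Fin m) ℂ}
    (hP : P.IsHermitian) (h : ∀ v ≠ 0, 0 < quadForm P v) : P.PosDef := by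
  refine Matrix.PosDef.of_dotProduct_mulVec_pos hP fun v hv => ?_
  rw [Complex.pos_iff]
  exact ⟨h v hv, (hP.im_star_dotProduct_mulVec_self v).symm⟩

theorem Matrix.PosSemidef.quadForm_nonneg {P : Matrix (Fin m) (Fin m) ℂ} (hP : P.PosSemidef)
    (v : Fin m → ℂ) : 0 ≤ quadForm P v := hP.re_dotProduct_nonneg v

theorem Matrix.PosDef.quadForm_pos {P : Matrix (Fin m) (Fin m) ℂ} (hP : P.PosDef)
    {v : Fin m → ℂ} (hv : v ≠ 0) : 0 < quadForm P v := hP.re_dotProduct_pos hv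

theorem isHermitian_real_smul_one (c : ℝ) :
    ((c : ℂ) • (1 : Matrix (Fin m) (Fin m) ℂ)).IsHermitian := by
  rw [Matrix.IsHermitian, Matrix.conjTranspose_smul, Matrix.conjTranspose_one, Complex.star_def,
    Complex.conj_ofReal]

theorem Matrix.IsHermitian.posSemidef_smul_one_sub {P : Matrix (Fin m) (Fin m) ℂ}
    (hP : P.IsHermitian) {c : ℝ} (hc : ‖P‖ ≤ c) :
    ((c : ℂ) • (1 : Matrix (Fin m) (Fin m) ℂ) - P).PosSemidef := by
  refine ((isHermitian_real_smul_one c).sub hP).posSemidef_of_quadForm fun v => ?_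
  rw [quadForm_sub, quadForm_smul_one]
  have h := (le_abs_self _).trans (abs_quadForm_le P v)
  have h0 : 0 ≤ (star v ⬝ᵥ v).re := by rw [re_star_dotProduct_self]; positivity
  nlinarith

/-- With `V = v v^*` and `s = |v|²` one has `V² = s V`, so `(s - V)² = s (s - V)` and `s - V` is
positive semidefinite. Pairing it with `P` under the trace gives the bound. -/
theorem Matrix.PosSemidef.quadForm_le_trace {P : Matrix (Fin m) (Fin m) ℂ} (hP : P.PosSemidef)
    (v : Fin m → ℂ) : quadForm P v ≤ P.trace.re * (star v ⬝ᵥ v).re := by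
  set s := (star v ⬝ᵥ v).re with hs
  have hs' : star v ⬝ᵥ v = (s : ℂ) := by
    apply Complex.ext
    · simp [hs]
    · have := (Matrix.isHermitian_one (n := Fin m) (α := ℂ)).im_star_dotProduct_mulVec_self v
      rw [Complex.ofReal_im]
      simpa using this
  have h0 : 0 ≤ s := by rw [hs, re_star_dotProduct_self]; positivity
  set V := Matrix.vecMulVec v (star v) with hV
  have hVH : Vᴴ = V := (Matrix.posSemidef_vecMulVec_self_star v).isHermitian
  have hVV : V * V = (s : ℂ) • V := by
    rw [hV, Matrix.vecMulVec_mul_vecMulVec, hs', Matrix.vecMulVec_smul]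
  rcases eq_or_lt_of_le h0 with h | h
  · have : v = 0 := by
      by_contra hv
      exact (re_star_dotProduct_self_pos hv).ne h
    simp [← h, quadForm, this]
  have hpsd : ((s : ℂ) • (1 : Matrix (Fin m) (Fin m) ℂ) - V).PosSemidef := by
    have h1 := Matrix.posSemidef_conjTranspose_mul_self ((s : ℂ) • (1 : Matrix _ _ ℂ) - V)
    rw [((isHermitian_real_smul_one s).sub hVH).eq] at h1
    have h2 : ((s : ℂ) • (1 : Matrix (Fin m) (Fin m) ℂ) - V) * ((s : ℂ) • 1 - V) =
        (s : ℂ) • ((s : ℂ) • 1 - V) := by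
      simp only [Matrix.mul_sub, Matrix.sub_mul, hVV, Matrix.smul_mul, Matrix.mul_smul,
        Matrix.one_mul, Matrix.mul_one, smul_sub]
      abel
    rw [h2] at h1
    have h3 := h1.smul (a := ((s⁻¹ : ℝ) : ℂ)) (by
      rw [Complex.zero_le_real]; positivity)
    rwa [smul_smul, ← Complex.ofReal_mul, inv_mul_cancel₀ h.ne', Complex.ofReal_one,
      one_smul] at h3
  have h4 := hP.re_trace_mul_nonneg hpsd
  rw [Matrix.mul_sub, Matrix.mul_smul, Matrix.mul_one, Matrix.trace_sub, Matrix.trace_smul,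
    Complex.sub_re, smul_eq_mul, Complex.re_ofReal_mul, hV, Matrix.mul_vecMulVec,
    Matrix.trace_vecMulVec, dotProduct_comm] at h4
  rw [quadForm]
  linarith

theorem Matrix.PosSemidef.norm_le_re_trace {P : Matrix (Fin m) (Fin m) ℂ} (hP : P.PosSemidef) :
    ‖P‖ ≤ P.trace.re := by
  obtain ⟨C, hC⟩ := hP.exists_eq_conjTranspose_mul_self
  have h1 : ‖P‖ = ‖C‖ ^ 2 := by rw [hC, Matrix.l2_opNorm_conjTranspose_mul_self, sq]
  have h0 := hP.re_trace_nonneg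
  rw [h1, ← Real.le_sqrt (norm_nonneg _) h0, Matrix.cstar_norm_def]
  refine ContinuousLinearMap.opNorm_le_bound _ (Real.sqrt_nonneg _) fun x => ?_
  rw [← sq_le_sq₀ (norm_nonneg _) (by positivity), mul_pow, Real.sq_sqrt h0]
  have h2 := hP.quadForm_le_trace x.ofLp
  rw [re_star_dotProduct_self] at h2
  refine le_trans (le_of_eq ?_) h2
  have h3 : Matrix.toEuclideanCLM (n := Fin m) (𝕜 := ℂ) C x = WithLp.toLp 2 (C *ᵥ x.ofLp) := rfl
  rw [h3, ← re_star_dotProduct_self, quadForm, hC, ← Matrix.mulVec_mulVec,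
    Matrix.dotProduct_mulVec _ Cᴴ, Matrix.star_mulVec]

/-- Cauchy–Schwarz in the form `|v|⁴ ≤ (v^* P v) (v^* P⁻¹ v)`, from the nonnegative quadratic
polynomial `r ↦ (r v - P v)^* P⁻¹ (r v - P v)` at its minimum. The second factor is then bounded by
the trace. A small value of the form of `P` thus forces a large `tr P⁻¹`. -/
theorem Matrix.PosDef.sq_le_quadForm_mul {P : Matrix (Fin m) (Fin m) ℂ} (hP : P.PosDef)
    {v : Fin m → ℂ} (hv : v ≠ 0) :
    (star v ⬝ᵥ v).re ≤ quadForm P v * P⁻¹.trace.re := by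
  set s := (star v ⬝ᵥ v).re with hs
  have hspos : 0 < s := re_star_dotProduct_self_pos hv
  have hdet := (Matrix.isUnit_iff_isUnit_det _).mp hP.isUnit
  set a := quadForm P v with ha
  set b := quadForm P⁻¹ v with hb
  have ha0 : 0 < a := hP.quadForm_pos hv
  have key : ∀ r : ℝ, 0 ≤ r ^ 2 * b - 2 * r * s + a := by
    intro r
    have h1 := hP.inv.posSemidef.quadForm_nonneg ((r : ℂ) • v - P *ᵥ v)
    have h2 : quadForm P⁻¹ ((r : ℂ) • v - P *ᵥ v) = r ^ 2 * b - 2 * r * s + a := by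
      have e1 : P⁻¹ *ᵥ (P *ᵥ v) = v := by
        rw [Matrix.mulVec_mulVec, Matrix.nonsing_inv_mul _ hdet, Matrix.one_mulVec]
      have e2 : star (P *ᵥ v) ⬝ᵥ P⁻¹ *ᵥ v = star v ⬝ᵥ v := by
        rw [Matrix.star_mulVec, hP.isHermitian.eq, ← Matrix.dotProduct_mulVec,
          Matrix.mulVec_mulVec, Matrix.mul_nonsing_inv _ hdet, Matrix.one_mulVec]
      have e3 : star (P *ᵥ v) ⬝ᵥ v = star v ⬝ᵥ P *ᵥ v := by
        rw [Matrix.star_mulVec, hP.isHermitian.eq, ← Matrix.dotProduct_mulVec]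
      rw [quadForm, Matrix.mulVec_sub, Matrix.mulVec_smul, e1, star_sub, star_smul,
        sub_dotProduct, dotProduct_sub, dotProduct_sub, smul_dotProduct, smul_dotProduct,
        dotProduct_smul, dotProduct_smul, e2, e3]
      simp only [smul_eq_mul, Complex.sub_re, Complex.star_def, Complex.conj_ofReal,
        Complex.re_ofReal_mul]
      rw [hb, ha, hs, quadForm, quadForm]
      ring
    rwa [h2] at h1
  have hle : b ≤ P⁻¹.trace.re * s := hP.inv.posSemidef.quadForm_le_trace v
  have hss : s ^ 2 ≤ a * b := by
    have hb0 : 0 < b := hP.inv.quadForm_pos hv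
    have := key (s / b)
    have h3 : (s / b) ^ 2 * b - 2 * (s / b) * s + a = a - s ^ 2 / b := by
      field_simp; ring
    rw [h3, sub_nonneg, div_le_iff₀ hb0] at this
    exact this
  have h5 : s * s ≤ (a * P⁻¹.trace.re) * s := by nlinarith
  exact le_of_mul_le_mul_right h5 hspos

theorem Matrix.PosDef.posSemidef_sub_smul_one {P : Matrix (Fin m) (Fin m) ℂ} (hP : P.PosDef)
    {τ : ℝ} (hτ : 0 < τ) (h : P⁻¹.trace.re ≤ τ) :
    (P - ((τ⁻¹ : ℝ) : ℂ) • (1 : Matrix (Fin m) (Fin m) ℂ)).PosSemidef := by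
  refine (hP.isHermitian.sub (isHermitian_real_smul_one _)).posSemidef_of_quadForm fun v => ?_
  rw [quadForm_sub, quadForm_smul_one, sub_nonneg]
  rcases eq_or_ne v 0 with rfl | hv
  · simp [quadForm]
  have h1 := hP.sq_le_quadForm_mul hv
  have h2 := hP.quadForm_pos hv
  rw [inv_mul_le_iff₀ hτ]
  nlinarith

theorem quadForm_conjTranspose_mul_mul_same {n : ℕ} (Y : Matrix (Fin n) (Fin n) ℂ)
    (Z : Matrix (Fin n) (Fin m) ℂ) (v : Fin m → ℂ) :
    quadForm (Zᴴ * Y * Z) v = quadForm Y (Z *ᵥ v) := by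
  rw [quadForm, quadForm, ← Matrix.mulVec_mulVec, ← Matrix.mulVec_mulVec,
    Matrix.dotProduct_mulVec _ Zᴴ, Matrix.star_mulVec]

theorem Matrix.PosDef.eq_zero_of_conjTranspose_mul_mul_eq_zero {Y Z : Matrix (Fin m) (Fin m) ℂ}
    (hY : Y.PosDef) (h : Zᴴ * Y * Z = 0) : Z = 0 := by
  refine Matrix.ext_of_mulVec_single fun i => ?_
  rw [Matrix.zero_mulVec]
  by_contra hv
  have h1 := hY.quadForm_pos hv
  rw [← quadForm_conjTranspose_mul_mul_same, h] at h1
  simp [quadForm] at h1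

end PositiveMatrices

/-! ### Integral trace functionals and the algebra of continuous matrix functions -/

section TraceFunctional

open scoped Matrix.Norms.L2Operator

variable {m : ℕ}

/-- The real part of the trace, as a continuous real-linear functional. -/
noncomputable def reTraceCLM (m : ℕ) : Matrix (Fin m) (Fin m) ℂ →L[ℝ] ℝ :=
  LinearMap.toContinuousLinearMap
    { toFun := fun M => M.trace.re
      map_add' := fun M N => by simp
      map_smul' := fun c M => by simp }

@[simp]
theorem reTraceCLM_apply (M : Matrix (Fin m) (Fin m) ℂ) : reTraceCLM m M = M.trace.re := rfl

theorem aestronglyMeasurable_matrix {X : Type*} [MeasurableSpace X] {μ : Measure X}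
    {F : X → Matrix (Fin m) (Fin m) ℂ}
    (hF : ∀ i j, AEStronglyMeasurable (fun x => F x i j) μ) : AEStronglyMeasurable F μ := by
  have h : F = fun x => ∑ i, ∑ j, F x i j • Matrix.single i j (1 : ℂ) := by
    funext x
    conv_lhs => rw [Matrix.matrix_eq_sum_single (F x)]
    simp [Matrix.smul_single]
  rw [h]
  exact Finset.aestronglyMeasurable_fun_sum _ fun i _ =>
    Finset.aestronglyMeasurable_fun_sum _ fun j _ => (hF i j).smul_const _

theorem IsSpectralDensity.aestronglyMeasurable {Φ : UnitTorus → Matrix (Fin m) (Fin m) ℂ}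
    (hΦ : IsSpectralDensity Φ) : AEStronglyMeasurable Φ torusMeasure :=
  aestronglyMeasurable_matrix hΦ.1

theorem IsSpectralDensity.exists_lower_bound {Φ : UnitTorus → Matrix (Fin m) (Fin m) ℂ}
    (hΦ : IsSpectralDensity Φ) : ∃ c : ℝ, 0 < c ∧ ∀ᵐ θ ∂torusMeasure,
      (Φ θ - (c : ℂ) • (1 : Matrix (Fin m) (Fin m) ℂ)).PosSemidef := by
  obtain ⟨-, c, C, hc, h⟩ := hΦ
  exact ⟨c, hc, h.mono fun θ hθ => hθ.1⟩

theorem IsSpectralDensity.posSemidef {Φ : UnitTorus → Matrix (Fin m) (Fin m) ℂ}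
    (hΦ : IsSpectralDensity Φ) : ∀ᵐ θ ∂torusMeasure, (Φ θ).PosSemidef := by
  obtain ⟨c, hc, h⟩ := hΦ.exists_lower_bound
  filter_upwards [h] with θ hθ
  have h1 := hθ.add (Matrix.PosSemidef.one.smul (a := (c : ℂ)) (by
    rw [Complex.zero_le_real]; exact hc.le))
  simpa using h1

theorem IsSpectralDensity.exists_norm_le {Φ : UnitTorus → Matrix (Fin m) (Fin m) ℂ}
    (hΦ : IsSpectralDensity Φ) : ∃ C : ℝ, ∀ᵐ θ ∂torusMeasure, ‖Φ θ‖ ≤ C := by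
  have h0 := hΦ.posSemidef
  obtain ⟨-, c, C, hc, h⟩ := hΦ
  refine ⟨C * m, ?_⟩
  filter_upwards [h0, h] with θ h1 h2
  refine h1.norm_le_re_trace.trans ?_
  have h3 := h2.2.re_trace_nonneg
  rw [Matrix.trace_sub, Matrix.trace_smul, Complex.sub_re, smul_eq_mul, Complex.re_ofReal_mul,
    Matrix.trace_one] at h3
  simp at h3
  linarith

theorem integrable_of_norm_le {X E : Type*} [MeasurableSpace X] {μ : Measure X}
    [IsFiniteMeasure μ] [NormedAddCommGroup E] {F : X → E} {C : ℝ}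
    (hF : AEStronglyMeasurable F μ) (hC : ∀ᵐ x ∂μ, ‖F x‖ ≤ C) : Integrable F μ :=
  (integrable_const C).mono' hF hC

theorem IsSpectralDensity.integrable {Φ : UnitTorus → Matrix (Fin m) (Fin m) ℂ}
    (hΦ : IsSpectralDensity Φ) : Integrable Φ torusMeasure := by
  obtain ⟨C, hC⟩ := hΦ.exists_norm_le
  exact integrable_of_norm_le hΦ.aestronglyMeasurable hC

theorem ContinuousMap.integrable_mul (h : C(UnitTorus, Matrix (Fin m) (Fin m) ℂ))
    {Φ : UnitTorus → Matrix (Fin m) (Fin m) ℂ} (hΦ : Integrable Φ torusMeasure) :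
    Integrable (fun θ => h θ * Φ θ) torusMeasure :=
  hΦ.bdd_mul (c := ‖h‖) h.continuous.aestronglyMeasurable
    (Eventually.of_forall fun θ => h.norm_coe_le_norm θ)

/-- The functional `h ↦ Re ∫ tr (h Φ)` on continuous matrix functions. -/
noncomputable def traceFunctional (Φ : UnitTorus → Matrix (Fin m) (Fin m) ℂ)
    (hΦ : Integrable Φ torusMeasure) : C(UnitTorus, Matrix (Fin m) (Fin m) ℂ) →L[ℝ] ℝ :=
  LinearMap.mkContinuous
    { toFun := fun h => ∫ θ, (h θ * Φ θ).trace.re ∂torusMeasure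
      map_add' := fun h k => by
        simp only [ContinuousMap.add_apply, Matrix.add_mul, Matrix.trace_add, Complex.add_re]
        exact integral_add ((reTraceCLM m).integrable_comp (h.integrable_mul hΦ))
          ((reTraceCLM m).integrable_comp (k.integrable_mul hΦ))
      map_smul' := fun c h => by
        simp only [RingHom.id_apply, smul_eq_mul]
        rw [← integral_const_mul]
        simp }
    (‖reTraceCLM m‖ * ∫ θ, ‖Φ θ‖ ∂torusMeasure) (fun h => by
      refine (norm_integral_le_integral_norm _).trans ?_
      rw [mul_right_comm, ← integral_const_mul]
      refine integral_mono ((reTraceCLM m).integrable_comp (h.integrable_mul hΦ)).norm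
        (hΦ.norm.const_mul _) fun θ => ?_
      refine ((reTraceCLM m).le_opNorm (h θ * Φ θ)).trans ?_
      rw [mul_assoc]
      gcongr
      refine (norm_mul_le _ _).trans ?_
      gcongr
      exact h.norm_coe_le_norm θ)

theorem traceFunctional_apply {Φ : UnitTorus → Matrix (Fin m) (Fin m) ℂ}
    (hΦ : Integrable Φ torusMeasure) (h : C(UnitTorus, Matrix (Fin m) (Fin m) ℂ)) :
    traceFunctional Φ hΦ h = ∫ θ, (h θ * Φ θ).trace.re ∂torusMeasure := rfl

/-- The coercivity used throughout the dual problem: a lower bound on the density makes the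
functional control `∫ tr` on positive functions. -/
theorem mul_integral_trace_le_traceFunctional {Φ : UnitTorus → Matrix (Fin m) (Fin m) ℂ}
    (hΦ : Integrable Φ torusMeasure) {c : ℝ} (hc : ∀ᵐ θ ∂torusMeasure,
      (Φ θ - (c : ℂ) • (1 : Matrix (Fin m) (Fin m) ℂ)).PosSemidef)
    {h : C(UnitTorus, Matrix (Fin m) (Fin m) ℂ)} (hh : ∀ θ, (h θ).PosSemidef) :
    c * ∫ θ, (h θ).trace.re ∂torusMeasure ≤ traceFunctional Φ hΦ h := by
  rw [traceFunctional_apply, ← integral_const_mul]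
  refine integral_mono_ae
    (((reTraceCLM m).continuous.comp h.continuous).integrable_torus.const_mul c)
    ((reTraceCLM m).integrable_comp (h.integrable_mul hΦ)) ?_
  filter_upwards [hc] with θ hθ
  exact (hh θ).mul_re_trace_le hθ

theorem integral_trace_nonneg {h : C(UnitTorus, Matrix (Fin m) (Fin m) ℂ)}
    (hh : ∀ θ, (h θ).PosSemidef) : 0 ≤ ∫ θ, (h θ).trace.re ∂torusMeasure :=
  integral_nonneg fun θ => (hh θ).re_trace_nonneg

theorem integral_trace_pos {h : C(UnitTorus, Matrix (Fin m) (Fin m) ℂ)}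
    (hh : ∀ θ, (h θ).PosSemidef) (h0 : h ≠ 0) : 0 < ∫ θ, (h θ).trace.re ∂torusMeasure := by
  have hc : Continuous fun θ => (h θ).trace.re := (reTraceCLM m).continuous.comp h.continuous
  obtain ⟨θ, hθ⟩ : ∃ θ, h θ ≠ 0 := by
    by_contra hcon
    push Not at hcon
    exact h0 (ContinuousMap.ext hcon)
  refine hc.integral_pos_of_hasCompactSupport_nonneg_nonzero
    (HasCompactSupport.of_compactSpace _) (fun θ => (hh θ).re_trace_nonneg) (x := θ) ?_
  intro hz
  have h1 := (hh θ).norm_le_re_trace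
  rw [hz] at h1
  exact hθ (norm_le_zero_iff.mp h1)

theorem isUnit_of_posDef {Δ : C(UnitTorus, Matrix (Fin m) (Fin m) ℂ)}
    (hΔ : ∀ θ, (Δ θ).PosDef) : IsUnit Δ :=
  (ContinuousMap.isUnit_iff_forall_isUnit Δ).mpr fun θ => (hΔ θ).isUnit

/-- Inversion in the Banach algebra of continuous matrix functions is the pointwise inverse. Its
continuity and Fréchet derivative in the uniform norm thus become available for `Δ⁻¹`. -/
theorem ringInverse_apply {Δ : C(UnitTorus, Matrix (Fin m) (Fin m) ℂ)}
    (hΔ : ∀ θ, (Δ θ).PosDef) (θ : UnitTorus) : Ring.inverse Δ θ = (Δ θ)⁻¹ := by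
  have h := congrArg (fun f : C(UnitTorus, Matrix (Fin m) (Fin m) ℂ) => f θ)
    (Ring.mul_inverse_cancel Δ (isUnit_of_posDef hΔ))
  exact (Matrix.inv_eq_right_inv h).symm

theorem ringInverse_posDef {Δ : C(UnitTorus, Matrix (Fin m) (Fin m) ℂ)}
    (hΔ : ∀ θ, (Δ θ).PosDef) (θ : UnitTorus) : (Ring.inverse Δ θ).PosDef := by
  rw [ringInverse_apply hΔ]; exact (hΔ θ).inv

/-- A pointwise positive definite continuous matrix function is uniformly coercive. -/
theorem exists_uniform_lower_bound {Δ : C(UnitTorus, Matrix (Fin m) (Fin m) ℂ)}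
    (hΔ : ∀ θ, (Δ θ).PosDef) : ∃ c : ℝ, 0 < c ∧ ∀ θ,
      (Δ θ - (c : ℂ) • (1 : Matrix (Fin m) (Fin m) ℂ)).PosSemidef := by
  set τ := ‖reTraceCLM m‖ * ‖Ring.inverse Δ‖ + 1 with hτ
  have hτ0 : 0 < τ := by positivity
  refine ⟨τ⁻¹, inv_pos.mpr hτ0, fun θ => (hΔ θ).posSemidef_sub_smul_one hτ0 ?_⟩
  rw [← ringInverse_apply hΔ]
  have h1 := (le_abs_self _).trans ((reTraceCLM m).le_opNorm (Ring.inverse Δ θ))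
  have h2 : ‖reTraceCLM m‖ * ‖Ring.inverse Δ θ‖ ≤ ‖reTraceCLM m‖ * ‖Ring.inverse Δ‖ := by
    gcongr; exact ContinuousMap.norm_coe_le_norm _ θ
  rw [reTraceCLM_apply] at h1
  linarith

theorem isSpectralDensity_of_continuous {Φ : UnitTorus → Matrix (Fin m) (Fin m) ℂ}
    (hc : Continuous Φ) (hpos : ∀ θ, (Φ θ).PosDef) : IsSpectralDensity Φ := by
  set F : C(UnitTorus, Matrix (Fin m) (Fin m) ℂ) := ⟨Φ, hc⟩ with hF
  obtain ⟨c, hc0, hcΦ⟩ := exists_uniform_lower_bound (Δ := F) hpos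
  refine ⟨fun i j => ((entryCLM i j).continuous.comp hc).aestronglyMeasurable, c, ‖F‖, hc0,
    Eventually.of_forall fun θ => ⟨hcΦ θ, ?_⟩⟩
  exact (hpos θ).isHermitian.posSemidef_smul_one_sub (F.norm_coe_le_norm θ)

theorem exists_pos_forall_add_posDef {Δ : C(UnitTorus, Matrix (Fin m) (Fin m) ℂ)}
    (hΔ : ∀ θ, (Δ θ).PosDef) : ∃ ε : ℝ, 0 < ε ∧
      ∀ h : C(UnitTorus, Matrix (Fin m) (Fin m) ℂ), (∀ θ, (h θ).IsHermitian) → ‖h‖ < ε →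
        ∀ θ, ((Δ + h) θ).PosDef := by
  obtain ⟨c, hc, hcΔ⟩ := exists_uniform_lower_bound hΔ
  refine ⟨c, hc, fun h hh hn θ => ?_⟩
  refine ((hΔ θ).isHermitian.add (hh θ)).posDef_of_quadForm fun v hv => ?_
  have h1 := (hcΔ θ).quadForm_nonneg v
  rw [quadForm_sub, quadForm_smul_one] at h1
  have h2 := abs_le.mp (abs_quadForm_le (h θ) v)
  have h3 := re_star_dotProduct_self_pos hv
  have h4 : ‖h θ‖ < c := (h.norm_coe_le_norm θ).trans_lt hn
  rw [quadForm_add]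
  nlinarith [h2.1]

end TraceFunctional

/-! ### The dual functional: stationarity, strict minimality, perturbation -/

section DualProblem

open scoped Matrix.Norms.L2Operator

variable {m : ℕ} {E : Type*} [NormedAddCommGroup E] [NormedSpace ℝ E]

/-- The domain of the dual problem: the multipliers `e` with `1 + T e` positive definite on the
whole circle. -/
def dualDomain (T : E →L[ℝ] C(UnitTorus, Matrix (Fin m) (Fin m) ℂ)) : Set E :=
  {e | ∀ θ, ((1 + T e) θ).PosDef}

/-- The dual functional `e ↦ L ((1 + T e)⁻¹) + ℓ e`. -/
noncomputable def dualFunctional (T : E →L[ℝ] C(UnitTorus, Matrix (Fin m) (Fin m) ℂ))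
    (L : C(UnitTorus, Matrix (Fin m) (Fin m) ℂ) →L[ℝ] ℝ) (l : E →L[ℝ] ℝ) (e : E) : ℝ :=
  L (Ring.inverse (1 + T e)) + l e

/-- The stationarity condition of the dual functional. -/
def IsDualCritical (T : E →L[ℝ] C(UnitTorus, Matrix (Fin m) (Fin m) ℂ))
    (L : C(UnitTorus, Matrix (Fin m) (Fin m) ℂ) →L[ℝ] ℝ) (l : E →L[ℝ] ℝ) (e : E) : Prop :=
  ∀ g, L (Ring.inverse (1 + T e) * T g * Ring.inverse (1 + T e)) = l g

variable {T : E →L[ℝ] C(UnitTorus, Matrix (Fin m) (Fin m) ℂ)}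
  {L : C(UnitTorus, Matrix (Fin m) (Fin m) ℂ) →L[ℝ] ℝ} {l : E →L[ℝ] ℝ}

theorem zero_mem_dualDomain : (0 : E) ∈ dualDomain T := fun θ => by
  rw [map_zero, add_zero]; exact Matrix.PosDef.one

theorem isOpen_dualDomain (hT : ∀ e θ, (T e θ).IsHermitian) : IsOpen (dualDomain T) := by
  rw [Metric.isOpen_iff]
  intro e he
  obtain ⟨ε, hε, h⟩ := exists_pos_forall_add_posDef he
  have hc : Tendsto (fun e' => ‖T (e' - e)‖) (𝓝 e) (𝓝 0) := by
    have h1 : Continuous fun e' => ‖T (e' - e)‖ := by fun_prop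
    simpa using h1.tendsto e
  obtain ⟨δ, hδ, hball⟩ := Metric.eventually_nhds_iff_ball.mp (hc.eventually (gt_mem_nhds hε))
  refine ⟨δ, hδ, fun e' he' θ => ?_⟩
  have h2 := h (T (e' - e)) (hT _) (hball e' he') θ
  rwa [map_sub, add_add_sub_cancel] at h2

theorem hasFDerivAt_dualFunctional {e : E} (he : e ∈ dualDomain T) :
    HasFDerivAt (dualFunctional T L l)
      ((L.comp (-(ContinuousLinearMap.mulLeftRight ℝ
        C(UnitTorus, Matrix (Fin m) (Fin m) ℂ) (Ring.inverse (1 + T e))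
          (Ring.inverse (1 + T e))))).comp T + l) e := by
  obtain ⟨u, hu⟩ := isUnit_of_posDef he
  have h1 : HasFDerivAt (fun e => 1 + T e) T e := T.hasFDerivAt.const_add 1
  have h2 := hasFDerivAt_ringInverse (𝕜 := ℝ) u
  rw [← Ring.inverse_unit, hu] at h2
  exact (L.hasFDerivAt.comp e (h2.comp e h1)).add l.hasFDerivAt

theorem continuousOn_dualFunctional : ContinuousOn (dualFunctional T L l) (dualDomain T) :=
  fun _ he => (hasFDerivAt_dualFunctional he).continuousAt.continuousWithinAt

theorem IsLocalMin.isDualCritical {e : E} (he : e ∈ dualDomain T)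
    (hmin : IsLocalMin (dualFunctional T L l) e) : IsDualCritical T L l e := by
  intro g
  have h1 := congrArg (fun φ : E →L[ℝ] ℝ => φ g)
    (hmin.hasFDerivAt_eq_zero (hasFDerivAt_dualFunctional he))
  simp only [add_apply, ContinuousLinearMap.comp_apply,
    neg_apply, ContinuousLinearMap.mulLeftRight_apply, map_neg,
    zero_apply] at h1
  linarith

/-- An exact formula without Taylor remainder. With `X`, `Y` the two inverses and `g` the increment
of `1 + T e`, the resolvent identities `X g Y = X - Y = Y g X` give `X g Y g X = Y - X + X g X`.
Stationarity turns `L (X g X)` into the increment of `l`. -/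
theorem IsDualCritical.dualFunctional_sub {e₀ e : E} (h₀ : e₀ ∈ dualDomain T)
    (he : e ∈ dualDomain T) (hc : IsDualCritical T L l e₀) :
    dualFunctional T L l e - dualFunctional T L l e₀ =
      L (Ring.inverse (1 + T e₀) * T (e - e₀) * Ring.inverse (1 + T e) * T (e - e₀) *
        Ring.inverse (1 + T e₀)) := by
  have h1 := hc (e - e₀)
  rw [map_sub l] at h1
  set X := Ring.inverse (1 + T e₀) with hX
  set Y := Ring.inverse (1 + T e) with hY
  have a1 : X * (1 + T e₀) = 1 := Ring.inverse_mul_cancel _ (isUnit_of_posDef h₀)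
  have a2 : (1 + T e₀) * X = 1 := Ring.mul_inverse_cancel _ (isUnit_of_posDef h₀)
  have b1 : Y * (1 + T e) = 1 := Ring.inverse_mul_cancel _ (isUnit_of_posDef he)
  have hg : T (e - e₀) = (1 + T e) - (1 + T e₀) := by rw [map_sub]; abel
  have b2 : (1 + T e) * Y = 1 := Ring.mul_inverse_cancel _ (isUnit_of_posDef he)
  have key : X * T (e - e₀) * Y * T (e - e₀) * X = Y - X + X * T (e - e₀) * X := by
    have c1 : X * T (e - e₀) * Y = X - Y := by
      rw [hg, mul_sub, sub_mul, a1, mul_assoc, b2, mul_one, one_mul]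
    have c2 : Y * T (e - e₀) * X = X - Y := by
      rw [hg, mul_sub, sub_mul, b1, mul_assoc, a2, mul_one, one_mul]
    rw [c1, sub_mul, sub_mul, c2]; abel
  rw [key, map_add, map_sub, h1, dualFunctional, dualFunctional]
  ring

/-- The difference formula applies the functional of `Ψ` to `(g X)^* Y (g X)`, which is positive
semidefinite and vanishes identically only if `g = 0`. Coercivity of `Ψ` makes the value strictly
positive. -/
theorem IsDualCritical.lt_dualFunctional {Ψ : UnitTorus → Matrix (Fin m) (Fin m) ℂ}
    (hΨ : IsSpectralDensity Ψ) (hT : ∀ e θ, (T e θ).IsHermitian) (hinj : Function.Injective T)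
    {e₀ e : E} (h₀ : e₀ ∈ dualDomain T) (he : e ∈ dualDomain T)
    (hc : IsDualCritical T (traceFunctional Ψ hΨ.integrable) l e₀) (hne : e ≠ e₀) :
    dualFunctional T (traceFunctional Ψ hΨ.integrable) l e₀ <
      dualFunctional T (traceFunctional Ψ hΨ.integrable) l e := by
  rw [← sub_pos, hc.dualFunctional_sub h₀ he]
  set g := e - e₀ with hg
  set X := Ring.inverse (1 + T e₀) with hX
  set Y := Ring.inverse (1 + T e) with hY
  have hpt : ∀ θ, (X * T g * Y * T g * X) θ = (T g θ * X θ)ᴴ * Y θ * (T g θ * X θ) := by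
    intro θ
    have hXH : (X θ)ᴴ = X θ := (ringInverse_posDef h₀ θ).isHermitian
    rw [Matrix.conjTranspose_mul, hXH, (hT g θ).eq]
    simp only [ContinuousMap.mul_apply, Matrix.mul_assoc]
  have hpsd : ∀ θ, ((X * T g * Y * T g * X) θ).PosSemidef := fun θ => by
    rw [hpt]
    exact (ringInverse_posDef he θ).posSemidef.conjTranspose_mul_mul_same _
  have hne0 : X * T g * Y * T g * X ≠ 0 := by
    intro h0
    have hTg : T g = 0 := by
      refine ContinuousMap.ext fun θ => ?_
      have h1 : (T g θ * X θ)ᴴ * Y θ * (T g θ * X θ) = 0 := by rw [← hpt, h0]; rfl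
      have h2 : T g θ * X θ = 0 :=
        (ringInverse_posDef he θ).eq_zero_of_conjTranspose_mul_mul_eq_zero h1
      have h5 : X θ * (1 + T e₀) θ = 1 :=
        congrArg (fun f : C(UnitTorus, Matrix (Fin m) (Fin m) ℂ) => f θ)
          (Ring.inverse_mul_cancel _ (isUnit_of_posDef h₀))
      calc T g θ = T g θ * (X θ * (1 + T e₀) θ) := by rw [h5, Matrix.mul_one]
        _ = 0 := by rw [← Matrix.mul_assoc, h2, Matrix.zero_mul]
    have : g = 0 := hinj (by rw [hTg, map_zero])
    exact hne (sub_eq_zero.mp this)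
  obtain ⟨c, hc0, hcΨ⟩ := hΨ.exists_lower_bound
  exact (mul_pos hc0 (integral_trace_pos hpsd hne0)).trans_le
    (mul_integral_trace_le_traceFunctional hΨ.integrable hcΨ hpsd)

/-- Stationary points of the dual functional persist, nearby, under small perturbations of its
linear part. -/
theorem IsDualCritical.exists_near [FiniteDimensional ℝ E]
    {Ψ : UnitTorus → Matrix (Fin m) (Fin m) ℂ}
    (hΨ : IsSpectralDensity Ψ) (hT : ∀ e θ, (T e θ).IsHermitian) (hinj : Function.Injective T)
    {e₀ : E} (h₀ : e₀ ∈ dualDomain T)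
    (hc : IsDualCritical T (traceFunctional Ψ hΨ.integrable) l e₀) {ε : ℝ} (hε : 0 < ε) :
    ∃ δ > 0, ∀ l' : E →L[ℝ] ℝ, ‖l' - l‖ < δ → ∃ e ∈ dualDomain T, ‖e - e₀‖ < ε ∧
      IsDualCritical T (traceFunctional Ψ hΨ.integrable) l' e := by
  have := FiniteDimensional.proper_real E
  set L := traceFunctional Ψ hΨ.integrable with hL
  obtain ⟨r₁, hr₁, hball⟩ := Metric.isOpen_iff.mp (isOpen_dualDomain hT) e₀ h₀
  set r := min (ε / 2) (r₁ / 2) with hr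
  have hr0 : 0 < r := lt_min (half_pos hε) (half_pos hr₁)
  have hsub : Metric.closedBall e₀ r ⊆ dualDomain T := by
    refine (Metric.closedBall_subset_ball ?_).trans hball
    exact (min_le_right _ _).trans_lt (half_lt_self hr₁)
  -- By compactness the strict minimum has a uniform gap `η` on the sphere. The sphere is empty when
  -- `E` is trivial, and then any gap works.
  have hsphere : ∃ η > 0, ∀ e ∈ Metric.sphere e₀ r,
      dualFunctional T L l e₀ + η ≤ dualFunctional T L l e := by
    rcases (Metric.sphere e₀ r).eq_empty_or_nonempty with hemp | hne
    · exact ⟨1, one_pos, fun e he => by simp [hemp] at he⟩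
    obtain ⟨e₁, he₁, hmin⟩ := (isCompact_sphere e₀ r).exists_isMinOn hne
      (continuousOn_dualFunctional.mono (Metric.sphere_subset_closedBall.trans hsub))
    have hne₁ : e₁ ≠ e₀ := by
      rintro rfl
      rw [mem_sphere_iff_norm, sub_self, norm_zero] at he₁
      exact hr0.ne he₁
    refine ⟨dualFunctional T L l e₁ - dualFunctional T L l e₀, sub_pos.mpr
      (hc.lt_dualFunctional hΨ hT hinj h₀ (hsub (Metric.sphere_subset_closedBall he₁)) hne₁),
      fun e he => ?_⟩
    have : dualFunctional T L l e₁ ≤ dualFunctional T L l e := hmin he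
    linarith
  obtain ⟨η, hη, hs⟩ := hsphere
  -- Over the distance `r` the perturbation changes increments of the functional by at most `‖l' -
  -- l‖ * r < η`. A minimizer on the closed ball therefore avoids the sphere and is a local minimum.
  refine ⟨η / r, div_pos hη hr0, fun l' hl' => ?_⟩
  obtain ⟨e, he, hmin⟩ := (isCompact_closedBall e₀ r).exists_isMinOn
    ⟨e₀, Metric.mem_closedBall_self hr0.le⟩
    ((continuousOn_dualFunctional (L := L) (l := l')).mono hsub)
  have hin : e ∈ Metric.ball e₀ r := by
    by_contra hcon
    have hes : e ∈ Metric.sphere e₀ r := by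
      rw [Metric.mem_ball, not_lt] at hcon
      exact le_antisymm he hcon
    have h1 := hs e hes
    have h2 : dualFunctional T L l' e ≤ dualFunctional T L l' e₀ :=
      hmin (Metric.mem_closedBall_self hr0.le)
    have h3 : |(l' - l) (e - e₀)| ≤ ‖l' - l‖ * r := by
      have := (l' - l).le_opNorm (e - e₀)
      rwa [mem_sphere_iff_norm.mp hes] at this
    have h4 : ‖l' - l‖ * r < η := by rwa [← lt_div_iff₀ hr0]
    have h5 := (abs_le.mp h3).1
    rw [sub_apply, map_sub, map_sub] at h5
    simp only [dualFunctional] at h1 h2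
    linarith
  refine ⟨e, hsub he, ?_, ?_⟩
  · rw [mem_ball_iff_norm] at hin
    exact hin.trans (((min_le_left _ _).trans_lt (half_lt_self hε)))
  · exact (hmin.isLocalMin (Metric.closedBall_mem_nhds_of_mem hin)).isDualCritical (hsub he)

end DualProblem

/-! ### Existence of a dual minimizer -/

section DualExistence

open scoped Matrix.Norms.L2Operator

/-- A zero of a nonnegative function is a minimum, so the first derivative vanishes there and
Taylor's bound is purely quadratic. -/
theorem ContDiff.exists_le_mul_sq_of_nonneg {q : ℝ → ℝ} (hq : ContDiff ℝ 2 q)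
    (h0 : ∀ t, 0 ≤ q t) {t₀ : ℝ} (hz : q t₀ = 0) :
    ∃ C > 0, ∀ t ∈ Set.Icc t₀ (t₀ + 1), q t ≤ C * (t - t₀) ^ 2 := by
  obtain ⟨C, hC⟩ := exists_taylor_mean_remainder_bound (f := q) (a := t₀) (b := t₀ + 1) (n := 1)
    (by linarith) (by
      have : ((1 : ℕ) : WithTop ℕ∞) + 1 = 2 := by norm_num
      rw [this]; exact hq.contDiffOn)
  have hmin : IsLocalMin q t₀ := Eventually.of_forall fun t => by rw [hz]; exact h0 t
  have hd : derivWithin q (Set.Icc t₀ (t₀ + 1)) t₀ = 0 := by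
    rw [(hq.differentiable (by norm_num)).differentiableAt.derivWithin
      (uniqueDiffOn_Icc (by linarith) t₀ (Set.left_mem_Icc.mpr (by linarith))), hmin.deriv_eq_zero]
  refine ⟨max C 1, lt_max_of_lt_right one_pos, fun t ht => ?_⟩
  have h1 := hC t ht
  rw [taylorWithinEval_succ, taylor_within_zero_eval, iteratedDerivWithin_one, hd, hz] at h1
  simp only [smul_zero, add_zero, sub_zero, Real.norm_eq_abs] at h1
  have h2 : C * (t - t₀) ^ 2 ≤ max C 1 * (t - t₀) ^ 2 := by gcongr; exact le_max_left _ _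
  exact ((le_abs_self _).trans h1).trans h2

theorem integral_torusMeasure_eq {f : UnitTorus → ℝ} (t₀ : ℝ) :
    ∫ θ, f θ ∂torusMeasure = (2 * Real.pi)⁻¹ * ∫ t in t₀..t₀ + 2 * Real.pi, f (t : UnitTorus) := by
  rw [AddCircle.intervalIntegral_preimage, AddCircle.volume_eq_smul_haarAddCircle,
    integral_smul_measure, ENNReal.toReal_ofReal Real.two_pi_pos.le, smul_eq_mul,
    inv_mul_cancel_left₀ Real.two_pi_pos.ne']

theorem mul_le_integral_of_le_on_arc {f : UnitTorus → ℝ} (hf : Continuous f) (h0 : ∀ θ, 0 ≤ f θ)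
    {t₀ η a : ℝ} (hη : 0 ≤ η) (hη' : η ≤ 2 * Real.pi)
    (ha : ∀ t ∈ Set.Icc t₀ (t₀ + η), a ≤ f (t : UnitTorus)) :
    (2 * Real.pi)⁻¹ * (η * a) ≤ ∫ θ, f θ ∂torusMeasure := by
  have hc : Continuous fun t : ℝ => f (t : UnitTorus) := hf.comp (AddCircle.continuous_mk' _)
  rw [integral_torusMeasure_eq t₀]
  have hpi := Real.two_pi_pos
  refine mul_le_mul_of_nonneg_left ?_ (inv_nonneg.mpr hpi.le)
  have h1 : ∫ t in t₀..t₀ + η, a ≤ ∫ t in t₀..t₀ + η, f (t : UnitTorus) :=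
    intervalIntegral.integral_mono_on (by linarith) intervalIntegrable_const
      (hc.intervalIntegrable _ _) ha
  have h2 : ∫ t in t₀..t₀ + η, f (t : UnitTorus) ≤
      ∫ t in t₀..t₀ + 2 * Real.pi, f (t : UnitTorus) :=
    intervalIntegral.integral_mono_interval le_rfl (by linarith) (by linarith)
      (Eventually.of_forall fun t => h0 _) (hc.intervalIntegrable _ _)
  simp only [intervalIntegral.integral_const, add_sub_cancel_left, smul_eq_mul] at h1
  exact h1.trans h2

variable {m : ℕ} {E : Type*} [NormedAddCommGroup E] [NormedSpace ℝ E]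
  {T : E →L[ℝ] C(UnitTorus, Matrix (Fin m) (Fin m) ℂ)}

/-- An injective linear map from a finite-dimensional space into `L¹` is bounded below. The `L¹`
norm is the relevant one because the dual functional controls only `∫ tr (1 + T e)`. -/
theorem exists_norm_le_mul_integral_norm [FiniteDimensional ℝ E] (hinj : Function.Injective T) :
    ∃ K : ℝ, 0 < K ∧ ∀ e, ‖e‖ ≤ K * ∫ θ, ‖T e θ‖ ∂torusMeasure := by
  let J : E →ₗ[ℝ] Lp (Matrix (Fin m) (Fin m) ℂ) 1 torusMeasure :=
    (ContinuousMap.toLp (E := Matrix (Fin m) (Fin m) ℂ) 1 torusMeasure ℝ).toLinearMap ∘ₗ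
      T.toLinearMap
  have hJ : LinearMap.ker J = ⊥ :=
    LinearMap.ker_eq_bot.mpr ((ContinuousMap.toLp_injective torusMeasure).comp hinj)
  obtain ⟨K, hK, hanti⟩ := J.exists_antilipschitzWith hJ
  refine ⟨K, hK, fun e => ?_⟩
  have h1 := hanti.le_mul_dist e 0
  rw [map_zero, dist_zero_right, dist_zero_right, L1.norm_eq_integral_norm] at h1
  refine h1.trans (le_of_eq ?_)
  congr 1
  refine integral_congr_ae ?_
  filter_upwards [ContinuousMap.coeFn_toLp (p := 1) (𝕜 := ℝ) torusMeasure (T e)] with θ hθ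
  exact congrArg norm hθ

theorem continuous_quadForm (v : Fin m → ℂ) :
    Continuous fun P : Matrix (Fin m) (Fin m) ℂ => quadForm P v :=
  Complex.continuous_re.comp
    (continuous_const.dotProduct (continuous_id.matrix_mulVec continuous_const))

/-- A limit of multipliers with bounded `∫ tr (1 + T e)⁻¹` stays in the dual domain: otherwise
`1 + T e` degenerates quadratically, and `∫ tr (1 + T e)⁻¹` diverges. -/
theorem mem_dualDomain_of_mem_closure (hT : ∀ e θ, (T e θ).IsHermitian)
    (hsmooth : ∀ e v, ContDiff ℝ 2 fun t : ℝ => quadForm (T e (t : UnitTorus)) v)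
    {K : Set E} {M : ℝ} (hK : K ⊆ dualDomain T)
    (hM : ∀ e ∈ K, ∫ θ, (Ring.inverse (1 + T e) θ).trace.re ∂torusMeasure ≤ M)
    {e : E} (he : e ∈ closure K) : e ∈ dualDomain T := by
  have hTc : ∀ θ v, Continuous fun e => quadForm ((1 + T e) θ) v := fun θ v =>
    (continuous_quadForm v).comp
      ((continuous_eval_const θ).comp (continuous_const.add T.continuous))
  -- Positive semidefiniteness passes to the limit; only strictness has to be proved.
  have hnonneg : ∀ θ v, 0 ≤ quadForm ((1 + T e) θ) v := by
    intro θ v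
    have hcl : IsClosed {e : E | 0 ≤ quadForm ((1 + T e) θ) v} :=
      isClosed_le continuous_const (hTc θ v)
    exact hcl.closure_subset_iff.mpr
      (fun e' he' => ((hK he') θ).posSemidef.quadForm_nonneg v) he
  intro θ
  refine (Matrix.isHermitian_one.add (hT e θ)).posDef_of_quadForm fun v hv => ?_
  refine lt_of_le_of_ne (hnonneg θ v) fun hzero => ?_
  obtain ⟨t₀, rfl⟩ := QuotientAddGroup.mk_surjective θ
  set s := (star v ⬝ᵥ v).re with hs
  have hs0 : 0 < s := re_star_dotProduct_self_pos hv
  have hq : ContDiff ℝ 2 fun t : ℝ => quadForm ((1 + T e) (t : UnitTorus)) v := by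
    have h1 : (fun t : ℝ => quadForm ((1 + T e) (t : UnitTorus)) v) =
        fun t : ℝ => quadForm 1 v + quadForm (T e (t : UnitTorus)) v :=
      funext fun t => quadForm_add _ _ v
    rw [h1]; exact contDiff_const.add (hsmooth e v)
  obtain ⟨C, hC0, hC⟩ := hq.exists_le_mul_sq_of_nonneg (fun t => hnonneg _ v) hzero.symm
  -- On an arc of length `η` after the zero, the form of `1 + T e` is at most `C η²`. An approximant
  -- `e'` in `K` adds at most another `C η²`, so `tr (1 + T e')⁻¹ ≥ s / (2 C η²)` there. The
  -- integral is at least a constant times `1 / η`.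
  have hmain : ∀ η : ℝ, 0 < η → η ≤ 1 → (2 * Real.pi)⁻¹ * (η * (s / (2 * C * η ^ 2))) ≤ M := by
    intro η hη hη1
    have hCη : 0 < C * η ^ 2 := by positivity
    have hTe : ∀ᶠ e' in 𝓝 e, ‖T (e' - e)‖ * s < C * η ^ 2 := by
      have h1 : Continuous fun e' => ‖T (e' - e)‖ * s := by fun_prop
      have h2 := h1.tendsto e
      rw [sub_self, map_zero, norm_zero, zero_mul] at h2
      exact h2.eventually (gt_mem_nhds hCη)
    obtain ⟨e', he'n, he'K⟩ := mem_closure_iff_nhds.mp he _ hTe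
    refine le_trans ?_ (hM e' he'K)
    have hpos := hK he'K
    refine mul_le_integral_of_le_on_arc
      ((reTraceCLM m).continuous.comp (Ring.inverse (1 + T e')).continuous)
      (fun θ => (ringInverse_posDef hpos θ).posSemidef.re_trace_nonneg) (t₀ := t₀) hη.le
      (by linarith [Real.pi_gt_three]) fun t ht => ?_
    have hqt := hC t ⟨ht.1, by linarith [ht.2]⟩
    have h1 : (t - t₀) ^ 2 ≤ η ^ 2 := by
      have h3 := ht.1
      have h4 := ht.2
      exact pow_le_pow_left₀ (by linarith) (by linarith) 2
    have h2 : quadForm ((1 + T e') (t : UnitTorus)) v ≤ 2 * C * η ^ 2 := by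
      have e1 : (1 + T e') (t : UnitTorus) = (1 + T e) (t : UnitTorus) + T (e' - e) t := by
        rw [map_sub]
        simp only [ContinuousMap.add_apply, ContinuousMap.sub_apply]
        abel
      rw [e1, quadForm_add]
      have h3 := (le_abs_self _).trans (abs_quadForm_le (T (e' - e) (t : UnitTorus)) v)
      have h4 : ‖T (e' - e) (t : UnitTorus)‖ * s ≤ ‖T (e' - e)‖ * s := by
        gcongr; exact ContinuousMap.norm_coe_le_norm _ _
      have h5 : C * (t - t₀) ^ 2 ≤ C * η ^ 2 := by gcongr
      have h6 : ‖T (e' - e)‖ * s < C * η ^ 2 := he'n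
      linarith
    have h7 := (hpos (t : UnitTorus)).sq_le_quadForm_mul hv
    rw [← ringInverse_apply hpos] at h7
    rw [div_le_iff₀ (by positivity), mul_comm]
    exact h7.trans (mul_le_mul_of_nonneg_right h2
      (ringInverse_posDef hpos _).posSemidef.re_trace_nonneg)
  have hpi := Real.pi_pos
  -- For this `η` the bound reads `s ≤ 4 π C N η ≤ s / 2`, against `s > 0`. Replacing `M` by `N`
  -- keeps the denominator positive.
  set N := max M 1 with hN
  have hN1 : 1 ≤ N := le_max_right _ _
  set η := min 1 (s / (8 * Real.pi * C * N)) with hη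
  have hη0 : 0 < η := lt_min one_pos (by positivity)
  have h1 := (hmain η hη0 (min_le_left _ _)).trans (le_max_left M 1)
  have h2 : (2 * Real.pi)⁻¹ * (η * (s / (2 * C * η ^ 2))) = s / (4 * Real.pi * C * η) := by
    field_simp; ring
  rw [h2, div_le_iff₀ (by positivity)] at h1
  have h3 : η ≤ s / (8 * Real.pi * C * N) := min_le_right _ _
  rw [le_div_iff₀ (by positivity)] at h3
  linarith

/-- The dual functional attains its minimum, and is stationary there. -/
theorem exists_isDualCritical [FiniteDimensional ℝ E] {l : E →L[ℝ] ℝ}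
    {Ψ Φ : UnitTorus → Matrix (Fin m) (Fin m) ℂ}
    (hΨ : IsSpectralDensity Ψ) (hΦ : IsSpectralDensity Φ) (hT : ∀ e θ, (T e θ).IsHermitian)
    (hinj : Function.Injective T)
    (hsmooth : ∀ e v, ContDiff ℝ 2 fun t : ℝ => quadForm (T e (t : UnitTorus)) v)
    (hl : ∀ e, l e = traceFunctional Φ hΦ.integrable (T e)) :
    ∃ e ∈ dualDomain T, IsDualCritical T (traceFunctional Ψ hΨ.integrable) l e := by
  have := FiniteDimensional.proper_real E
  set L := traceFunctional Ψ hΨ.integrable with hL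
  set F := traceFunctional Φ hΦ.integrable with hF
  obtain ⟨c, hc, hcΨ⟩ := hΨ.exists_lower_bound
  obtain ⟨c₁, hc₁, hcΦ⟩ := hΦ.exists_lower_bound
  set K : Set E := {e | e ∈ dualDomain T ∧ dualFunctional T L l e ≤ dualFunctional T L l 0}
    with hK
  -- Up to a constant, the linear term is the functional of the coercive `Φ` on `1 + T e`. Both
  -- parts of the dual functional are then nonnegative on the domain, up to that constant, so each
  -- is bounded on the sublevel set `K`.
  have hl' : ∀ e, l e = F (1 + T e) - F 1 := fun e => by rw [hl, map_add]; ring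
  have hlow : ∀ e ∈ dualDomain T, c * ∫ θ, (Ring.inverse (1 + T e) θ).trace.re ∂torusMeasure ≤
      L (Ring.inverse (1 + T e)) := fun e he =>
    mul_integral_trace_le_traceFunctional _ hcΨ fun θ => (ringInverse_posDef he θ).posSemidef
  have hlow₁ : ∀ e ∈ dualDomain T, c₁ * ∫ θ, ((1 + T e) θ).trace.re ∂torusMeasure ≤
      F (1 + T e) := fun e he =>
    mul_integral_trace_le_traceFunctional _ hcΦ fun θ => (he θ).posSemidef
  have hnn : ∀ e ∈ dualDomain T, 0 ≤ ∫ θ, (Ring.inverse (1 + T e) θ).trace.re ∂torusMeasure :=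
    fun e he => integral_trace_nonneg fun θ => (ringInverse_posDef he θ).posSemidef
  have hnn₁ : ∀ e ∈ dualDomain T, 0 ≤ ∫ θ, ((1 + T e) θ).trace.re ∂torusMeasure :=
    fun e he => integral_trace_nonneg fun θ => (he θ).posSemidef
  set J₀ := dualFunctional T L l 0 with hJ₀
  have hM : ∀ e ∈ K, ∫ θ, (Ring.inverse (1 + T e) θ).trace.re ∂torusMeasure ≤ (J₀ + F 1) / c := by
    intro e he
    rw [le_div_iff₀ hc, mul_comm]
    have h1 := he.2
    rw [dualFunctional, hl'] at h1
    have h2 := hlow e he.1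
    have h3 := hlow₁ e he.1
    have h4 := mul_nonneg hc₁.le (hnn₁ e he.1)
    linarith
  have hM₁ : ∀ e ∈ K, ∫ θ, ((1 + T e) θ).trace.re ∂torusMeasure ≤ (J₀ + F 1) / c₁ := by
    intro e he
    rw [le_div_iff₀ hc₁, mul_comm]
    have h1 := he.2
    rw [dualFunctional, hl'] at h1
    have h2 := hlow e he.1
    have h3 := hlow₁ e he.1
    have h4 := mul_nonneg hc.le (hnn e he.1)
    linarith
  obtain ⟨κ, hκ, hnorm⟩ := exists_norm_le_mul_integral_norm hinj
  have hbdd : Bornology.IsBounded K := by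
    refine (Metric.isBounded_closedBall (x := (0 : E))
      (r := κ * ((J₀ + F 1) / c₁ + ‖(1 : C(UnitTorus, Matrix (Fin m) (Fin m) ℂ))‖))).subset
      fun e he => ?_
    rw [mem_closedBall_zero_iff]
    refine (hnorm e).trans ?_
    gcongr
    have h1 : ∀ θ, ‖T e θ‖ ≤
        ((1 + T e) θ).trace.re + ‖(1 : C(UnitTorus, Matrix (Fin m) (Fin m) ℂ))‖ := by
      intro θ
      have e1 : T e θ = (1 + T e) θ - (1 : C(UnitTorus, Matrix (Fin m) (Fin m) ℂ)) θ := by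
        rw [ContinuousMap.add_apply, add_sub_cancel_left]
      rw [e1]
      exact (norm_sub_le _ _).trans (add_le_add (he.1 θ).posSemidef.norm_le_re_trace
        (ContinuousMap.norm_coe_le_norm _ θ))
    have i1 : Integrable (fun θ => ((1 + T e) θ).trace.re) torusMeasure :=
      ((reTraceCLM m).continuous.comp (1 + T e).continuous).integrable_torus
    refine (integral_mono (T e).continuous.norm.integrable_torus
      (i1.add (integrable_const _)) h1).trans ?_
    rw [integral_add' i1 (integrable_const _), integral_const]
    simp only [probReal_univ, one_smul]
    linarith [hM₁ e he]
  -- The bound `hM` on `∫ tr (1 + T e)⁻¹` prevents limits from reaching the boundary of the open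
  -- domain; continuity preserves the inequality.
  have hclosed : IsClosed K := by
    rw [← closure_subset_iff_isClosed]
    intro e he
    have hed := mem_dualDomain_of_mem_closure hT hsmooth (fun e he => he.1) hM he
    refine ⟨hed, ?_⟩
    have hcont := (hasFDerivAt_dualFunctional (L := L) (l := l) hed).continuousAt
    have := hcont.continuousWithinAt (s := K)
    have hne : (𝓝[K] e).NeBot := mem_closure_iff_nhdsWithin_neBot.mp he
    exact le_of_tendsto this (eventually_mem_nhdsWithin.mono fun e' he' => he'.2)
  have hcomp : IsCompact K := Metric.isCompact_of_isClosed_isBounded hclosed hbdd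
  have h0K : (0 : E) ∈ K := ⟨zero_mem_dualDomain, le_rfl⟩
  obtain ⟨e, heK, hmin⟩ := hcomp.exists_isMinOn ⟨0, h0K⟩
    (continuousOn_dualFunctional.mono fun e he => he.1)
  refine ⟨e, heK.1, IsLocalMin.isDualCritical heK.1 ?_⟩
  filter_upwards [(isOpen_dualDomain hT).mem_nhds heK.1] with e' he'
  by_cases h : e' ∈ K
  · exact hmin h
  · have h1 : J₀ < dualFunctional T L l e' := by
      by_contra hcon
      exact h ⟨he', not_lt.mp hcon⟩
    exact (heK.2.trans_lt h1).le

end DualExistence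

/-! ### Spectral factors and the Hellinger distance -/

section Hellinger

open scoped Matrix.Norms.L2Operator

variable {m : ℕ}

/-- The positive square root of the Hermitian part of a matrix, through the continuous functional
calculus. -/
noncomputable def hermitianSqrt (P : Matrix (Fin m) (Fin m) ℂ) : Matrix (Fin m) (Fin m) ℂ :=
  cfc Real.sqrt ((1 / 2 : ℂ) • (P + Pᴴ))

theorem isSelfAdjoint_hermitianPart (P : Matrix (Fin m) (Fin m) ℂ) :
    IsSelfAdjoint ((1 / 2 : ℂ) • (P + Pᴴ)) := by
  rw [IsSelfAdjoint, Matrix.star_eq_conjTranspose, Matrix.conjTranspose_smul,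
    Matrix.conjTranspose_add, Matrix.conjTranspose_conjTranspose, add_comm Pᴴ]
  simp

/-- Passing to the Hermitian part makes the square root continuous on the whole matrix space, so its
composition with a measurable spectrum is measurable. -/
theorem continuous_hermitianSqrt :
    Continuous (hermitianSqrt : Matrix (Fin m) (Fin m) ℂ → Matrix (Fin m) (Fin m) ℂ) := by
  refine Continuous.cfc_of_mem_nhdsSet (s := Set.univ) Real.sqrt Filter.univ_mem ?_
    isSelfAdjoint_hermitianPart Real.continuous_sqrt.continuousOn
  exact (continuous_id.add continuous_id.matrix_conjTranspose).const_smul (1 / 2 : ℂ)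

open scoped MatrixOrder in
theorem Matrix.PosSemidef.hermitianSqrt_mul_conjTranspose {P : Matrix (Fin m) (Fin m) ℂ}
    (hP : P.PosSemidef) : hermitianSqrt P * (hermitianSqrt P)ᴴ = P := by
  have h1 : (1 / 2 : ℂ) • (P + Pᴴ) = P := by
    rw [hP.isHermitian.eq, ← two_smul ℂ P, smul_smul]; norm_num
  have h2 : IsSelfAdjoint P := hP.isHermitian
  have h3 : (hermitianSqrt P)ᴴ = hermitianSqrt P := (cfc_predicate Real.sqrt _ : IsSelfAdjoint _)
  rw [h3, hermitianSqrt, h1, ← cfc_mul Real.sqrt Real.sqrt P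
    Real.continuous_sqrt.continuousOn Real.continuous_sqrt.continuousOn]
  conv_rhs => rw [← cfc_id ℝ P]
  refine cfc_congr fun x hx => ?_
  exact Real.mul_self_sqrt (spectrum_nonneg_of_nonneg hP.nonneg hx)

/-- The C*-identity. It bounds all factors of a given spectrum by the same constant. -/
theorem norm_sq_of_mul_conjTranspose_eq {W P : Matrix (Fin m) (Fin m) ℂ} (h : W * Wᴴ = P) :
    ‖W‖ ^ 2 = ‖P‖ := by
  have h1 := Matrix.l2_opNorm_conjTranspose_mul_self Wᴴ
  rw [Matrix.conjTranspose_conjTranspose, h, Matrix.l2_opNorm_conjTranspose] at h1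
  rw [h1, sq]

/-- The squared Frobenius norm. -/
noncomputable def frobeniusSq (V : Matrix (Fin m) (Fin m) ℂ) : ℝ := (V * Vᴴ).trace.re

theorem frobeniusSq_eq_sum (V : Matrix (Fin m) (Fin m) ℂ) :
    frobeniusSq V = ∑ i, ∑ j, ‖V i j‖ ^ 2 := by
  rw [frobeniusSq, Matrix.trace, Complex.re_sum]
  refine Finset.sum_congr rfl fun i _ => ?_
  rw [Matrix.diag_apply, Matrix.mul_apply, Complex.re_sum]
  refine Finset.sum_congr rfl fun j _ => ?_
  rw [Matrix.conjTranspose_apply, Complex.star_def, Complex.mul_conj, Complex.normSq_eq_norm_sq,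
    Complex.ofReal_re]

theorem frobeniusSq_nonneg (V : Matrix (Fin m) (Fin m) ℂ) : 0 ≤ frobeniusSq V :=
  (Matrix.posSemidef_self_mul_conjTranspose V).re_trace_nonneg

theorem norm_sq_le_frobeniusSq (V : Matrix (Fin m) (Fin m) ℂ) : ‖V‖ ^ 2 ≤ frobeniusSq V := by
  rw [norm_sq_of_mul_conjTranspose_eq rfl]
  exact (Matrix.posSemidef_self_mul_conjTranspose V).norm_le_re_trace

/-- Essentially bounded, measurable matrix functions on the circle. -/
def IsEssBounded (F : UnitTorus → Matrix (Fin m) (Fin m) ℂ) : Prop :=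
  AEStronglyMeasurable F torusMeasure ∧ ∃ C : ℝ, ∀ᵐ θ ∂torusMeasure, ‖F θ‖ ≤ C

variable {F H Φ Ψ W : UnitTorus → Matrix (Fin m) (Fin m) ℂ}

theorem IsEssBounded.integrable (hF : IsEssBounded F) : Integrable F torusMeasure := by
  obtain ⟨h, C, hC⟩ := hF
  exact integrable_of_norm_le h hC

theorem IsEssBounded.integrable_re_trace (hF : IsEssBounded F) :
    Integrable (fun θ => (F θ).trace.re) torusMeasure :=
  (reTraceCLM m).integrable_comp hF.integrable

theorem IsEssBounded.mul (hF : IsEssBounded F) (hH : IsEssBounded H) :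
    IsEssBounded fun θ => F θ * H θ := by
  obtain ⟨h₁, C, hC⟩ := hF
  obtain ⟨h₂, D, hD⟩ := hH
  refine ⟨h₁.mul h₂, C * D, ?_⟩
  filter_upwards [hC, hD] with θ hc hd
  exact (norm_mul_le _ _).trans
    (mul_le_mul hc hd (norm_nonneg _) ((norm_nonneg _).trans hc))

theorem IsEssBounded.sub (hF : IsEssBounded F) (hH : IsEssBounded H) :
    IsEssBounded fun θ => F θ - H θ := by
  obtain ⟨h₁, C, hC⟩ := hF
  obtain ⟨h₂, D, hD⟩ := hH
  refine ⟨h₁.sub h₂, C + D, ?_⟩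
  filter_upwards [hC, hD] with θ hc hd
  exact (norm_sub_le _ _).trans (add_le_add hc hd)

theorem IsEssBounded.conjTranspose (hF : IsEssBounded F) : IsEssBounded fun θ => (F θ)ᴴ := by
  obtain ⟨h₁, C, hC⟩ := hF
  refine ⟨continuous_id.matrix_conjTranspose.comp_aestronglyMeasurable h₁, C, ?_⟩
  filter_upwards [hC] with θ hc
  rwa [Matrix.l2_opNorm_conjTranspose]

theorem isEssBounded_continuousMap (h : C(UnitTorus, Matrix (Fin m) (Fin m) ℂ)) :
    IsEssBounded h :=
  ⟨h.continuous.aestronglyMeasurable, ‖h‖, Eventually.of_forall h.norm_coe_le_norm⟩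

theorem IsSpectralDensity.isEssBounded (hΦ : IsSpectralDensity Φ) : IsEssBounded Φ :=
  ⟨hΦ.aestronglyMeasurable, hΦ.exists_norm_le⟩

theorem IsEssBounded.memLp_apply (hF : IsEssBounded F) (i j : Fin m) :
    MemLp (fun θ => F θ i j) 2 torusMeasure := by
  obtain ⟨h₁, C, hC⟩ := hF
  exact (entryCLM i j).comp_memLp' (MemLp.of_bound h₁ C hC)

theorem isEssBounded_of_mul_conjTranspose (hW : AEStronglyMeasurable W torusMeasure)
    (hΦ : IsEssBounded Φ) (h : ∀ᵐ θ ∂torusMeasure, W θ * (W θ)ᴴ = Φ θ) : IsEssBounded W := by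
  obtain ⟨-, C, hC⟩ := hΦ
  refine ⟨hW, √C, ?_⟩
  filter_upwards [hC, h] with θ h1 h2
  exact Real.le_sqrt_of_sq_le ((norm_sq_of_mul_conjTranspose_eq h2).trans_le h1)

theorem IsSpectralFactor.isEssBounded (hW : IsSpectralFactor W Φ) (hΦ : IsSpectralDensity Φ) :
    IsEssBounded W :=
  isEssBounded_of_mul_conjTranspose
    (aestronglyMeasurable_matrix fun i j => (hW.1 i j).aestronglyMeasurable) hΦ.isEssBounded hW.2

theorem IsSpectralDensity.exists_factor (hΦ : IsSpectralDensity Φ) :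
    ∃ W, IsSpectralFactor W Φ := by
  have h : ∀ᵐ θ ∂torusMeasure, hermitianSqrt (Φ θ) * (hermitianSqrt (Φ θ))ᴴ = Φ θ :=
    hΦ.posSemidef.mono fun θ hθ => hθ.hermitianSqrt_mul_conjTranspose
  exact ⟨fun θ => hermitianSqrt (Φ θ), (isEssBounded_of_mul_conjTranspose
    (continuous_hermitianSqrt.comp_aestronglyMeasurable hΦ.aestronglyMeasurable)
    hΦ.isEssBounded h).memLp_apply, h⟩

theorem IsEssBounded.integrable_frobeniusSq (hF : IsEssBounded F) :
    Integrable (fun θ => frobeniusSq (F θ)) torusMeasure :=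
  (hF.mul hF.conjTranspose).integrable_re_trace

theorem IsEssBounded.matrixL2Norm_eq (hF : IsEssBounded F) :
    matrixL2Norm F = ENNReal.ofReal √(∫ θ, frobeniusSq (F θ) ∂torusMeasure) := by
  have h1 : ∀ θ, ∑ i, ∑ j, ‖F θ i j‖ₑ ^ 2 = ENNReal.ofReal (frobeniusSq (F θ)) := by
    intro θ
    rw [frobeniusSq_eq_sum, ENNReal.ofReal_sum_of_nonneg fun i _ => by positivity]
    refine Finset.sum_congr rfl fun i _ => ?_
    rw [ENNReal.ofReal_sum_of_nonneg fun i _ => by positivity]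
    refine Finset.sum_congr rfl fun j _ => ?_
    rw [ENNReal.ofReal_pow (norm_nonneg _), ofReal_norm]
  rw [matrixL2Norm]
  simp only [h1]
  rw [← ofReal_integral_eq_lintegral_ofReal hF.integrable_frobeniusSq
    (Eventually.of_forall fun θ => frobeniusSq_nonneg _), Real.sqrt_eq_rpow,
    ENNReal.ofReal_rpow_of_nonneg (integral_nonneg fun θ => frobeniusSq_nonneg _) (by norm_num)]

/-- The candidate optimum `Δ⁻¹ Ψ Δ⁻¹`. -/
noncomputable def sandwich (Δ : C(UnitTorus, Matrix (Fin m) (Fin m) ℂ))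
    (Ψ : UnitTorus → Matrix (Fin m) (Fin m) ℂ) : UnitTorus → Matrix (Fin m) (Fin m) ℂ :=
  fun θ => Ring.inverse Δ θ * Ψ θ * Ring.inverse Δ θ

variable {Δ : C(UnitTorus, Matrix (Fin m) (Fin m) ℂ)}

theorem isEssBounded_sandwich (Δ : C(UnitTorus, Matrix (Fin m) (Fin m) ℂ))
    (hΨ : IsSpectralDensity Ψ) : IsEssBounded (sandwich Δ Ψ) :=
  ((isEssBounded_continuousMap _).mul hΨ.isEssBounded).mul (isEssBounded_continuousMap _)

theorem isSpectralDensity_sandwich (hΔ : ∀ θ, (Δ θ).PosDef) (hΨ : IsSpectralDensity Ψ) :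
    IsSpectralDensity (sandwich Δ Ψ) := by
  obtain ⟨hm, C, hC⟩ := isEssBounded_sandwich Δ hΨ
  obtain ⟨c, hc, hcΨ⟩ := hΨ.exists_lower_bound
  have hpos := ringInverse_posDef hΔ
  set X := Ring.inverse Δ with hX
  have hXX : ∀ θ, ((X * X) θ).PosDef := fun θ => by
    have h1 := Matrix.PosDef.conjTranspose_mul_self (X θ)
      (Matrix.mulVec_injective_of_isUnit (hpos θ).isUnit)
    rwa [(hpos θ).isHermitian.eq] at h1
  obtain ⟨d, hd, hdX⟩ := exists_uniform_lower_bound hXX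
  -- The lower constant comes from `X Ψ X ≥ c X² ≥ c d`.
  refine ⟨fun i j => (entryCLM i j).continuous.comp_aestronglyMeasurable hm, c * d, C,
    mul_pos hc hd, ?_⟩
  filter_upwards [hC, hcΨ, hΨ.posSemidef] with θ h1 h2 h3
  have hXH : (X θ)ᴴ = X θ := (hpos θ).isHermitian
  constructor
  · have e1 := h2.mul_mul_conjTranspose_same (X θ)
    have e2 := (hdX θ).smul (a := (c : ℂ)) (by rw [Complex.zero_le_real]; exact hc.le)
    have e3 := e1.add e2
    rw [hXH] at e3
    convert e3 using 1
    simp only [sandwich, ← hX, ContinuousMap.mul_apply, Matrix.mul_sub, Matrix.sub_mul,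
      Matrix.mul_smul, Matrix.smul_mul, Matrix.mul_one, smul_sub, smul_smul, Complex.ofReal_mul]
    abel
  · have e1 := h3.mul_mul_conjTranspose_same (X θ)
    rw [hXH] at e1
    exact e1.isHermitian.posSemidef_smul_one_sub h1

theorem IsSpectralFactor.sandwich (hΔ : ∀ θ, (Δ θ).PosDef) (hΨ : IsSpectralDensity Ψ)
    (hW : IsSpectralFactor W Ψ) :
    IsSpectralFactor (fun θ => Ring.inverse Δ θ * W θ) (sandwich Δ Ψ) := by
  refine ⟨((isEssBounded_continuousMap (Ring.inverse Δ)).mul (hW.isEssBounded hΨ)).memLp_apply, ?_⟩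
  filter_upwards [hW.2] with θ h
  rw [Matrix.conjTranspose_mul, (ringInverse_posDef hΔ θ).isHermitian.eq, _root_.sandwich, ← h]
  simp only [Matrix.mul_assoc]

/-- Completing the square in the Hellinger distance. -/
theorem frobeniusSq_sub_eq {D X U V P Q : Matrix (Fin m) (Fin m) ℂ}
    (hX : X.IsHermitian) (hDX : D * X = 1) (hU : U * Uᴴ = P) (hV : V * Vᴴ = Q) :
    frobeniusSq (U - V) = P.trace.re - (X * P).trace.re - ((D - 1) * Q).trace.re +
      ((V - X * U)ᴴ * D * (V - X * U)).trace.re := by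
  have hXD : X * D = 1 := mul_eq_one_comm.mp hDX
  have e0 : (V - X * U)ᴴ * D * (V - X * U) =
      Vᴴ * (D * V) - Vᴴ * U - Uᴴ * V + Uᴴ * (X * U) := by
    have h1 : (V - X * U)ᴴ * D = Vᴴ * D - Uᴴ := by
      rw [Matrix.conjTranspose_sub, Matrix.conjTranspose_mul, hX.eq, Matrix.sub_mul,
        Matrix.mul_assoc Uᴴ, hXD, Matrix.mul_one]
    rw [h1, Matrix.mul_sub, Matrix.sub_mul, Matrix.sub_mul, Matrix.mul_assoc Vᴴ D (X * U),
      ← Matrix.mul_assoc D X U, hDX, Matrix.one_mul, Matrix.mul_assoc]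
    abel
  have t1 : (Vᴴ * (D * V)).trace = (D * Q).trace := by
    rw [Matrix.trace_mul_comm, Matrix.mul_assoc, hV]
  have t2 : (Uᴴ * (X * U)).trace = (X * P).trace := by
    rw [Matrix.trace_mul_comm, Matrix.mul_assoc, hU]
  have t3 : (Vᴴ * U).trace = (U * Vᴴ).trace := Matrix.trace_mul_comm _ _
  have t4 : (Uᴴ * V).trace = (V * Uᴴ).trace := Matrix.trace_mul_comm _ _
  rw [e0, frobeniusSq, Matrix.conjTranspose_sub, Matrix.sub_mul, Matrix.mul_sub, Matrix.mul_sub,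
    Matrix.sub_mul, Matrix.one_mul, hU, hV]
  simp only [Matrix.trace_add, Matrix.trace_sub, t1, t2, t3, t4, Complex.add_re, Complex.sub_re]
  ring

/-- The minimal squared Hellinger distance over the spectra `Φ` with `Re ∫ tr ((Δ - 1) Φ) = k`. -/
noncomputable def hellingerMinSq (Δ : C(UnitTorus, Matrix (Fin m) (Fin m) ℂ))
    (Ψ : UnitTorus → Matrix (Fin m) (Fin m) ℂ) (k : ℝ) : ℝ :=
  ∫ θ, (Ψ θ).trace.re ∂torusMeasure - ∫ θ, (Ring.inverse Δ θ * Ψ θ).trace.re ∂torusMeasure - k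

theorem integral_frobeniusSq_sub_eq (hΔ : ∀ θ, (Δ θ).PosDef) (hΨ : IsSpectralDensity Ψ)
    (hΦ : IsSpectralDensity Φ) {U V : UnitTorus → Matrix (Fin m) (Fin m) ℂ}
    (hU : IsSpectralFactor U Ψ) (hV : IsSpectralFactor V Φ) :
    ∫ θ, frobeniusSq (U θ - V θ) ∂torusMeasure =
      hellingerMinSq Δ Ψ (∫ θ, ((Δ θ - 1) * Φ θ).trace.re ∂torusMeasure) +
      ∫ θ, ((V θ - Ring.inverse Δ θ * U θ)ᴴ * Δ θ *
        (V θ - Ring.inverse Δ θ * U θ)).trace.re ∂torusMeasure := by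
  have bU := hU.isEssBounded hΨ
  have bV := hV.isEssBounded hΦ
  have bX := isEssBounded_continuousMap (Ring.inverse Δ)
  have bE := bV.sub (bX.mul bU)
  have i1 := hΨ.isEssBounded.integrable_re_trace
  have i2 := (bX.mul hΨ.isEssBounded).integrable_re_trace
  have i3 := (((isEssBounded_continuousMap Δ).sub (isEssBounded_continuousMap 1)).mul
    hΦ.isEssBounded).integrable_re_trace
  have i4 := ((bE.conjTranspose.mul (isEssBounded_continuousMap Δ)).mul bE).integrable_re_trace
  have hpt : (fun θ => frobeniusSq (U θ - V θ)) =ᵐ[torusMeasure] fun θ =>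
      (Ψ θ).trace.re - (Ring.inverse Δ θ * Ψ θ).trace.re - ((Δ θ - 1) * Φ θ).trace.re +
      ((V θ - Ring.inverse Δ θ * U θ)ᴴ * Δ θ * (V θ - Ring.inverse Δ θ * U θ)).trace.re := by
    filter_upwards [hU.2, hV.2] with θ h1 h2
    exact frobeniusSq_sub_eq (ringInverse_posDef hΔ θ).isHermitian
      (congrArg (fun f : C(UnitTorus, Matrix (Fin m) (Fin m) ℂ) => f θ)
        (Ring.mul_inverse_cancel Δ (isUnit_of_posDef hΔ))) h1 h2
  rw [integral_congr_ae hpt, hellingerMinSq, ← integral_sub i1 i2]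
  refine (integral_add ((i1.sub i2).sub i3) i4).trans ?_
  congr 1
  exact integral_sub (i1.sub i2) i3

/-- Near-optimality controls the `Δ`-weighted square; this converts it into closeness of the factors
in `L₂`. -/
theorem integral_frobeniusSq_le (hΔ : ∀ θ, (Δ θ).PosDef) : ∃ c : ℝ, 0 < c ∧
    ∀ F, IsEssBounded F → c * ∫ θ, frobeniusSq (F θ) ∂torusMeasure ≤
      ∫ θ, ((F θ)ᴴ * Δ θ * F θ).trace.re ∂torusMeasure := by
  obtain ⟨c, hc, hcΔ⟩ := exists_uniform_lower_bound hΔ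
  refine ⟨c, hc, fun F hF => ?_⟩
  rw [← integral_const_mul]
  refine integral_mono (hF.integrable_frobeniusSq.const_mul c)
    ((hF.conjTranspose.mul (isEssBounded_continuousMap Δ)).mul hF).integrable_re_trace fun θ => ?_
  have h1 := (Matrix.posSemidef_self_mul_conjTranspose (F θ)).mul_re_trace_le (hcΔ θ)
  refine h1.trans (le_of_eq ?_)
  rw [Matrix.mul_assoc, Matrix.trace_mul_comm, Matrix.mul_assoc]

theorem hellingerMinSq_le (hΔ : ∀ θ, (Δ θ).PosDef) (hΨ : IsSpectralDensity Ψ)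
    (hΦ : IsSpectralDensity Φ) {U V : UnitTorus → Matrix (Fin m) (Fin m) ℂ}
    (hU : IsSpectralFactor U Ψ) (hV : IsSpectralFactor V Φ) :
    hellingerMinSq Δ Ψ (∫ θ, ((Δ θ - 1) * Φ θ).trace.re ∂torusMeasure) ≤
      ∫ θ, frobeniusSq (U θ - V θ) ∂torusMeasure := by
  rw [integral_frobeniusSq_sub_eq hΔ hΨ hΦ hU hV, le_add_iff_nonneg_right]
  exact integral_nonneg fun θ =>
    ((hΔ θ).posSemidef.conjTranspose_mul_mul_same _).re_trace_nonneg

theorem le_hellingerDist (hΔ : ∀ θ, (Δ θ).PosDef) (hΨ : IsSpectralDensity Ψ)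
    (hΦ : IsSpectralDensity Φ) :
    ENNReal.ofReal √(hellingerMinSq Δ Ψ (∫ θ, ((Δ θ - 1) * Φ θ).trace.re ∂torusMeasure)) ≤
      hellingerDist Φ Ψ := by
  refine le_sInf ?_
  rintro d ⟨U, V, hU, hV, rfl⟩
  have h := ((hU.isEssBounded hΨ).sub (hV.isEssBounded hΦ)).matrixL2Norm_eq
  refine le_of_le_of_eq ?_ h.symm
  exact ENNReal.ofReal_le_ofReal (Real.sqrt_le_sqrt (hellingerMinSq_le hΔ hΨ hΦ hU hV))

/-- For any factor `U` of `Ψ`, the pair `(U, Δ⁻¹ U)` makes the completed square vanish, so the lower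
bound is attained. Nonnegativity is recorded because `√` sends negative numbers to zero. -/
theorem hellingerDist_sandwich_le (hΔ : ∀ θ, (Δ θ).PosDef) (hΨ : IsSpectralDensity Ψ) :
    0 ≤ hellingerMinSq Δ Ψ (∫ θ, ((Δ θ - 1) * sandwich Δ Ψ θ).trace.re ∂torusMeasure) ∧
    hellingerDist (sandwich Δ Ψ) Ψ ≤ ENNReal.ofReal
      √(hellingerMinSq Δ Ψ (∫ θ, ((Δ θ - 1) * sandwich Δ Ψ θ).trace.re ∂torusMeasure)) := by
  obtain ⟨U, hU⟩ := hΨ.exists_factor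
  have hV := hU.sandwich hΔ hΨ
  have h1 := integral_frobeniusSq_sub_eq hΔ hΨ (isSpectralDensity_sandwich hΔ hΨ) hU hV
  simp only [sub_self, Matrix.mul_zero, Matrix.trace_zero, Complex.zero_re, integral_zero,
    add_zero] at h1
  refine ⟨h1 ▸ integral_nonneg fun θ => frobeniusSq_nonneg _, sInf_le ⟨U, _, hU, hV, ?_⟩⟩
  rw [← h1]
  exact (((hU.isEssBounded hΨ).sub
    (hV.isEssBounded (isSpectralDensity_sandwich hΔ hΨ))).matrixL2Norm_eq).symm

/-- A spectrum on the same affine hyperplane which is as close to `Ψ` as `Δ⁻¹ Ψ Δ⁻¹` is equal to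
it. -/
theorem ae_eq_sandwich_of_hellingerDist_le (hΔ : ∀ θ, (Δ θ).PosDef) (hΨ : IsSpectralDensity Ψ)
    (hΦ : IsSpectralDensity Φ)
    (hk : ∫ θ, ((Δ θ - 1) * Φ θ).trace.re ∂torusMeasure =
      ∫ θ, ((Δ θ - 1) * sandwich Δ Ψ θ).trace.re ∂torusMeasure)
    (hle : hellingerDist Φ Ψ ≤ hellingerDist (sandwich Δ Ψ) Ψ) :
    Φ =ᵐ[torusMeasure] sandwich Δ Ψ := by
  obtain ⟨h0, hdist⟩ := hellingerDist_sandwich_le hΔ hΨ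
  rw [← hk] at h0 hdist
  set μ := hellingerMinSq Δ Ψ (∫ θ, ((Δ θ - 1) * Φ θ).trace.re ∂torusMeasure) with hμ
  have bS := isEssBounded_sandwich Δ hΨ
  obtain ⟨-, C₁, hC₁⟩ := hΦ.isEssBounded
  obtain ⟨-, C₂, hC₂⟩ := id bS
  obtain ⟨c, hc, hcΔ⟩ := integral_frobeniusSq_le hΔ
  -- `√C₁` and `√C₂` bound the factors of `Φ` and of `Δ⁻¹ Ψ Δ⁻¹`. They do not depend on the choice
  -- of factors, which varies with `ε` below.
  set R := √C₁ + √C₂ with hR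
  have bD := hΦ.isEssBounded.sub bS
  have hint : Integrable (fun θ => ‖Φ θ - sandwich Δ Ψ θ‖ ^ 2) torusMeasure := by
    obtain ⟨hm, C, hC⟩ := bD
    refine integrable_of_norm_le (C := C ^ 2) (hm.norm.pow 2) ?_
    filter_upwards [hC] with θ hθ
    rw [Real.norm_of_nonneg (by positivity)]
    exact pow_le_pow_left₀ (norm_nonneg _) hθ 2
  -- Attainment of the infimum defining `hellingerDist Φ Ψ` is not known, so near-minimizing factors
  -- are used. The square term in the completed identity is then less than `ε`.
  have hsmall : ∀ ε : ℝ, 0 < ε →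
      ∫ θ, ‖Φ θ - sandwich Δ Ψ θ‖ ^ 2 ∂torusMeasure ≤ R ^ 2 / c * ε := by
    intro ε hε
    have hlt : hellingerDist Φ Ψ < ENNReal.ofReal √(μ + ε) :=
      (hle.trans hdist).trans_lt ((ENNReal.ofReal_lt_ofReal_iff (Real.sqrt_pos.mpr
        (by linarith))).mpr (Real.sqrt_lt_sqrt h0 (by linarith)))
    obtain ⟨d, ⟨U, V, hU, hV, rfl⟩, hd⟩ := sInf_lt_iff.mp hlt
    have bU := hU.isEssBounded hΨ
    have bV := hV.isEssBounded hΦ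
    have bE := bV.sub ((isEssBounded_continuousMap (Ring.inverse Δ)).mul bU)
    have hY := hU.sandwich hΔ hΨ
    have h1 : matrixL2Norm (U - V) =
        ENNReal.ofReal √(∫ θ, frobeniusSq (U θ - V θ) ∂torusMeasure) := (bU.sub bV).matrixL2Norm_eq
    rw [h1, ENNReal.ofReal_lt_ofReal_iff (Real.sqrt_pos.mpr (by linarith)),
      Real.sqrt_lt_sqrt_iff (integral_nonneg fun θ => frobeniusSq_nonneg _),
      integral_frobeniusSq_sub_eq hΔ hΨ hΦ hU hV] at hd
    have h2 := hcΔ _ bE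
    have h3 : c * ∫ θ, frobeniusSq (V θ - Ring.inverse Δ θ * U θ) ∂torusMeasure ≤ ε := by linarith
    have h4 : ∫ θ, ‖Φ θ - sandwich Δ Ψ θ‖ ^ 2 ∂torusMeasure ≤
        ∫ θ, R ^ 2 * frobeniusSq (V θ - Ring.inverse Δ θ * U θ) ∂torusMeasure := by
      refine integral_mono_ae hint (bE.integrable_frobeniusSq.const_mul _) ?_
      filter_upwards [hV.2, hY.2, hC₁, hC₂] with θ hv hy h1 h2
      set Y := Ring.inverse Δ θ * U θ with hYdef
      -- The identity `V V^* - Y Y^* = (V - Y) V^* + Y (V - Y)^*` passes from factors to spectra.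
      have e1 : Φ θ - sandwich Δ Ψ θ = (V θ - Y) * (V θ)ᴴ + Y * (V θ - Y)ᴴ := by
        rw [← hv, ← hy, Matrix.conjTranspose_sub, Matrix.sub_mul, Matrix.mul_sub]; abel
      have nV : ‖V θ‖ ≤ √C₁ :=
        Real.le_sqrt_of_sq_le ((norm_sq_of_mul_conjTranspose_eq hv).trans_le h1)
      have nY : ‖Y‖ ≤ √C₂ :=
        Real.le_sqrt_of_sq_le ((norm_sq_of_mul_conjTranspose_eq hy).trans_le h2)
      have e2 : ‖Φ θ - sandwich Δ Ψ θ‖ ≤ R * ‖V θ - Y‖ := by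
        rw [e1]
        refine (norm_add_le _ _).trans ?_
        have a1 := Matrix.l2_opNorm_mul (V θ - Y) (V θ)ᴴ
        have a2 := Matrix.l2_opNorm_mul Y (V θ - Y)ᴴ
        rw [Matrix.l2_opNorm_conjTranspose] at a1 a2
        have a3 : ‖V θ - Y‖ * ‖V θ‖ ≤ ‖V θ - Y‖ * √C₁ := by gcongr
        have a4 : ‖Y‖ * ‖V θ - Y‖ ≤ √C₂ * ‖V θ - Y‖ := by gcongr
        rw [hR]; linarith
      refine (pow_le_pow_left₀ (norm_nonneg _) e2 2).trans ?_
      rw [mul_pow]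
      gcongr
      exact norm_sq_le_frobeniusSq _
    rw [integral_const_mul] at h4
    refine h4.trans ?_
    rw [div_mul_eq_mul_div, mul_div_assoc]
    gcongr
    rw [le_div_iff₀ hc, mul_comm]
    exact h3
  have hzero : ∫ θ, ‖Φ θ - sandwich Δ Ψ θ‖ ^ 2 ∂torusMeasure = 0 := by
    refine le_antisymm ?_ (integral_nonneg fun θ => by positivity)
    have ht : Tendsto (fun ε : ℝ => R ^ 2 / c * ε) (𝓝[>] 0) (𝓝 0) := by
      have h1 : Continuous fun ε : ℝ => R ^ 2 / c * ε := by fun_prop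
      have h2 := h1.tendsto 0
      rw [mul_zero] at h2
      exact h2.mono_left nhdsWithin_le_nhds
    exact ge_of_tendsto ht (eventually_mem_nhdsWithin.mono fun ε hε => hsmall ε hε)
  rw [integral_eq_zero_iff_of_nonneg (fun θ => by positivity) hint] at hzero
  filter_upwards [hzero] with θ hθ
  have h1 : ‖Φ θ - sandwich Δ Ψ θ‖ ^ 2 = 0 := hθ
  exact sub_eq_zero.mp (norm_eq_zero.mp (pow_eq_zero_iff two_ne_zero |>.mp h1))

end Hellinger

/-! ### Multipliers, optimality, and continuity in the covariance -/

section Multipliers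

open scoped Matrix.Norms.L2Operator

variable {n m : ℕ}

/-- `Λ ↦ G^* (Λ + Λ^*) G`, as a real-linear map into the continuous matrix functions. -/
noncomputable def gramMap {A : Matrix (Fin n) (Fin n) ℂ} (hA : IsStabilityMatrix A)
    (B : Matrix (Fin n) (Fin m) ℂ) :
    Matrix (Fin n) (Fin n) ℂ →ₗ[ℝ] C(UnitTorus, Matrix (Fin m) (Fin m) ℂ) where
  toFun Λ := ⟨fun θ => (transferFunction A B θ)ᴴ * (Λ + Λᴴ) * transferFunction A B θ,
    ((hA.continuous_transferFunction B).matrix_conjTranspose.matrix_mul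
      continuous_const).matrix_mul (hA.continuous_transferFunction B)⟩
  map_add' Λ M := by
    ext1 θ
    simp only [ContinuousMap.coe_mk, ContinuousMap.add_apply, Matrix.conjTranspose_add,
      Matrix.mul_add, Matrix.add_mul]
    abel
  map_smul' c Λ := by
    ext1 θ
    simp [Matrix.conjTranspose_smul, ← smul_add]

theorem gramMap_apply {A : Matrix (Fin n) (Fin n) ℂ} (hA : IsStabilityMatrix A)
    (B : Matrix (Fin n) (Fin m) ℂ) (Λ : Matrix (Fin n) (Fin n) ℂ) (θ : UnitTorus) :
    gramMap hA B Λ θ = (transferFunction A B θ)ᴴ * (Λ + Λᴴ) * transferFunction A B θ := rfl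

theorem isHermitian_gramMap {A : Matrix (Fin n) (Fin n) ℂ} (hA : IsStabilityMatrix A)
    (B : Matrix (Fin n) (Fin m) ℂ) (Λ : Matrix (Fin n) (Fin n) ℂ) (θ : UnitTorus) :
    (gramMap hA B Λ θ).IsHermitian := by
  rw [gramMap_apply]
  exact Matrix.isHermitian_conjTranspose_mul_mul _ (Matrix.isHermitian_add_transpose_self Λ)

/-- Two derivatives in the angle are what the quadratic degeneration argument requires. -/
theorem IsStabilityMatrix.contDiff_circleResolvent {A : Matrix (Fin n) (Fin n) ℂ}
    (hA : IsStabilityMatrix A) :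
    ContDiff ℝ 2 fun t : ℝ => circleResolvent A (t : UnitTorus) := by
  have h1 : ContDiff ℝ 2 fun t : ℝ => (AddCircle.toCircle (t : UnitTorus) : ℂ) := by
    simp only [AddCircle.toCircle_apply_mk, Circle.coe_exp]
    have h2 : ContDiff ℝ 2 fun t : ℝ => ((2 * Real.pi / (2 * Real.pi) * t : ℝ) : ℂ) :=
      Complex.ofRealCLM.contDiff.comp (contDiff_const.mul contDiff_id)
    exact (h2.mul contDiff_const).cexp
  rw [contDiff_iff_contDiffAt]
  intro t
  obtain ⟨u, hu⟩ := hA.isUnit_sub (t : UnitTorus)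
  have h3 : ContDiffAt ℝ 2 (fun t : ℝ => (AddCircle.toCircle (t : UnitTorus) : ℂ) •
      (1 : Matrix (Fin n) (Fin n) ℂ) - A) t :=
    ((h1.smul contDiff_const).sub contDiff_const).contDiffAt
  have h4 : ContDiffAt ℝ 2 Ring.inverse ((AddCircle.toCircle (t : UnitTorus) : ℂ) •
      (1 : Matrix (Fin n) (Fin n) ℂ) - A) := by
    rw [← hu]; exact contDiffAt_ringInverse ℝ u
  have h5 := ContDiffAt.comp (f := fun t : ℝ => (AddCircle.toCircle (t : UnitTorus) : ℂ) •
      (1 : Matrix (Fin n) (Fin n) ℂ) - A) t h4 h3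
  refine h5.congr_of_eventuallyEq (Eventually.of_forall fun s => ?_)
  exact Matrix.nonsing_inv_eq_ringInverse _

/-- The quadratic form at a fixed vector, as a continuous real-linear functional. -/
noncomputable def quadFormCLM (v : Fin m → ℂ) : Matrix (Fin m) (Fin m) ℂ →L[ℝ] ℝ :=
  LinearMap.toContinuousLinearMap
    { toFun := fun P => quadForm P v
      map_add' := fun P Q => quadForm_add P Q v
      map_smul' := fun c P => by simp [quadForm, Matrix.smul_mulVec] }

theorem contDiff_quadForm_gramMap {A : Matrix (Fin n) (Fin n) ℂ} (hA : IsStabilityMatrix A)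
    (B : Matrix (Fin n) (Fin m) ℂ) (Λ : Matrix (Fin n) (Fin n) ℂ) (v : Fin m → ℂ) :
    ContDiff ℝ 2 fun t : ℝ => quadForm (gramMap hA B Λ (t : UnitTorus)) v := by
  have h1 := hA.contDiff_circleResolvent
  have h2 : ContDiff ℝ 2 fun t : ℝ => star (circleResolvent A (t : UnitTorus)) :=
    (starL' ℝ (A := Matrix (Fin n) (Fin n) ℂ)).contDiff.comp h1
  have h3 := (quadFormCLM (B *ᵥ v)).contDiff.comp ((h2.mul contDiff_const).mul h1)
    (f := fun t : ℝ => star (circleResolvent A (t : UnitTorus)) * (Λ + Λᴴ) *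
      circleResolvent A (t : UnitTorus))
  convert h3 using 2 with t
  rw [gramMap_apply, transferFunction_eq, Matrix.conjTranspose_mul]
  refine Eq.trans ?_ (quadForm_conjTranspose_mul_mul_same _ B v)
  simp only [Matrix.star_eq_conjTranspose, Matrix.mul_assoc]

theorem IsStabilityMatrix.integrable_state {A : Matrix (Fin n) (Fin n) ℂ}
    (hA : IsStabilityMatrix A) (B : Matrix (Fin n) (Fin m) ℂ)
    {Φ : UnitTorus → Matrix (Fin m) (Fin m) ℂ} (hΦ : Integrable Φ torusMeasure) :
    Integrable (fun θ => transferFunction A B θ * Φ θ * (transferFunction A B θ)ᴴ)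
      torusMeasure := by
  have hG := hA.continuous_transferFunction B
  have hc : Continuous fun p : Matrix (Fin n) (Fin m) ℂ × Matrix (Fin m) (Fin m) ℂ =>
      p.1 * p.2 * p.1ᴴ :=
    (continuous_fst.matrix_mul continuous_snd).matrix_mul continuous_fst.matrix_conjTranspose
  have hm₁ : AEStronglyMeasurable (transferFunction A B) torusMeasure := hG.aestronglyMeasurable
  have hm := hc.comp_aestronglyMeasurable (hm₁.prodMk hΦ.1)
  obtain ⟨C, hC⟩ := isCompact_univ.exists_bound_of_continuousOn hG.continuousOn
  refine Integrable.mono' (hΦ.norm.const_mul (C ^ 2)) hm (Eventually.of_forall fun θ => ?_)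
  have h1 : ‖transferFunction A B θ‖ ≤ C := hC θ trivial
  have h0 : 0 ≤ C := (norm_nonneg _).trans h1
  have h2 := Matrix.l2_opNorm_mul (transferFunction A B θ) (Φ θ)
  have h3 := Matrix.l2_opNorm_mul (transferFunction A B θ * Φ θ) (transferFunction A B θ)ᴴ
  rw [Matrix.l2_opNorm_conjTranspose] at h3
  have h4 : ‖transferFunction A B θ * Φ θ‖ ≤ C * ‖Φ θ‖ :=
    h2.trans (mul_le_mul_of_nonneg_right h1 (norm_nonneg _))
  have h5 := h3.trans (mul_le_mul h4 h1 (norm_nonneg _) (mul_nonneg h0 (norm_nonneg _)))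
  exact h5.trans_eq (by ring)

/-- Cyclicity of the trace: `gramMap` is the adjoint of the covariance map, up to the symmetrization
of `Λ`. -/
theorem traceFunctional_gramMap {A : Matrix (Fin n) (Fin n) ℂ} (hA : IsStabilityMatrix A)
    (B : Matrix (Fin n) (Fin m) ℂ) {Φ : UnitTorus → Matrix (Fin m) (Fin m) ℂ}
    (hΦ : Integrable Φ torusMeasure) (Λ : Matrix (Fin n) (Fin n) ℂ) :
    traceFunctional Φ hΦ (gramMap hA B Λ) =
      ((Λ + Λᴴ) * stateCovariance A B Φ).trace.re := by
  have hi := hA.integrable_state B hΦ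
  rw [stateCovariance_eq_integral hi, ← integral_const_mul_of_integrable hi, traceFunctional_apply]
  refine Eq.trans ?_ ((reTraceCLM n).integral_comp_comm (hi.const_mul (Λ + Λᴴ)))
  congr 1
  funext θ
  rw [gramMap_apply, reTraceCLM_apply]
  congr 1
  rw [Matrix.mul_assoc, Matrix.mul_assoc, Matrix.trace_mul_comm]
  simp only [Matrix.mul_assoc]

theorem isHermitian_stateCovariance {A : Matrix (Fin n) (Fin n) ℂ} (hA : IsStabilityMatrix A)
    (B : Matrix (Fin n) (Fin m) ℂ) {Φ : UnitTorus → Matrix (Fin m) (Fin m) ℂ}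
    (hΦ : IsSpectralDensity Φ) : (stateCovariance A B Φ).IsHermitian := by
  have hi := hA.integrable_state B hΦ.integrable
  rw [stateCovariance_eq_integral hi, Matrix.IsHermitian, ← integral_conjTranspose hi]
  refine integral_congr_ae ?_
  filter_upwards [hΦ.posSemidef] with θ hθ
  exact (Matrix.isHermitian_mul_mul_conjTranspose _ hθ.isHermitian)

/-- The map `Λ ↦ Λ + Λ^*` on a space of multipliers. -/
noncomputable def symmetrization (E : Submodule ℝ (Matrix (Fin n) (Fin n) ℂ)) :
    E →L[ℝ] Matrix (Fin n) (Fin n) ℂ :=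
  LinearMap.toContinuousLinearMap
    { toFun := fun Λ : E => Λ.1 + Λ.1ᴴ
      map_add' := fun Λ M => by
        rw [Submodule.coe_add, Matrix.conjTranspose_add]; abel
      map_smul' := fun c Λ => by
        simp [Matrix.conjTranspose_smul] }

/-- The functional `Λ ↦ Re tr ((Λ + Λ^*) S)` on a space of multipliers. -/
noncomputable def covarianceFunctional (E : Submodule ℝ (Matrix (Fin n) (Fin n) ℂ))
    (S : Matrix (Fin n) (Fin n) ℂ) : E →L[ℝ] ℝ :=
  (reTraceCLM n).comp
    (((ContinuousLinearMap.mul ℝ (Matrix (Fin n) (Fin n) ℂ)).flip S).comp (symmetrization E))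

theorem continuous_covarianceFunctional (E : Submodule ℝ (Matrix (Fin n) (Fin n) ℂ)) :
    Continuous (covarianceFunctional E) :=
  continuous_const.clm_comp
    (((ContinuousLinearMap.mul ℝ (Matrix (Fin n) (Fin n) ℂ)).flip.continuous).clm_comp
      continuous_const)

theorem covarianceFunctional_apply (E : Submodule ℝ (Matrix (Fin n) (Fin n) ℂ))
    (S : Matrix (Fin n) (Fin n) ℂ) (Λ : E) :
    covarianceFunctional E S Λ = ((Λ.1 + Λ.1ᴴ) * S).trace.re := rfl

/-- A space of multipliers on which `gramMap` is injective, and which is as large as possible. -/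
theorem exists_multiplierSpace {A : Matrix (Fin n) (Fin n) ℂ} (hA : IsStabilityMatrix A)
    (B : Matrix (Fin n) (Fin m) ℂ) : ∃ E : Submodule ℝ (Matrix (Fin n) (Fin n) ℂ),
      IsCompl (LinearMap.ker (gramMap hA B)) E :=
  Submodule.exists_isCompl _

/-- The restriction of `gramMap` to a space of multipliers. -/
noncomputable def gramMapOn {A : Matrix (Fin n) (Fin n) ℂ} (hA : IsStabilityMatrix A)
    (B : Matrix (Fin n) (Fin m) ℂ) (E : Submodule ℝ (Matrix (Fin n) (Fin n) ℂ)) :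
    E →L[ℝ] C(UnitTorus, Matrix (Fin m) (Fin m) ℂ) :=
  LinearMap.toContinuousLinearMap ((gramMap hA B).domRestrict E)

variable {A : Matrix (Fin n) (Fin n) ℂ} {B : Matrix (Fin n) (Fin m) ℂ}
  {E : Submodule ℝ (Matrix (Fin n) (Fin n) ℂ)} {S : Matrix (Fin n) (Fin n) ℂ}
  {Ψ : UnitTorus → Matrix (Fin m) (Fin m) ℂ}

theorem gramMapOn_apply (hA : IsStabilityMatrix A) (Λ : E) :
    gramMapOn hA B E Λ = gramMap hA B Λ.1 := rfl

theorem gramMapOn_injective (hA : IsStabilityMatrix A)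
    (hE : IsCompl (LinearMap.ker (gramMap hA B)) E) : Function.Injective (gramMapOn hA B E) := by
  intro x y hxy
  have h1 : gramMap hA B (x.1 - y.1) = 0 := by rw [map_sub]; exact sub_eq_zero.mpr hxy
  have h2 : x.1 - y.1 ∈ LinearMap.ker (gramMap hA B) ⊓ E := ⟨h1, E.sub_mem x.2 y.2⟩
  rw [hE.inf_eq_bot, Submodule.mem_bot, sub_eq_zero] at h2
  exact Subtype.ext h2

/-- The candidate attached to a stationary multiplier satisfies the moment constraint. -/
theorem IsDualCritical.stateCovariance_sandwich (hA : IsStabilityMatrix A)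
    (hE : IsCompl (LinearMap.ker (gramMap hA B)) E) (hΨ : IsSpectralDensity Ψ)
    (hS : S ∈ PGamma A B) {e : E} (he : e ∈ dualDomain (gramMapOn hA B E))
    (hc : IsDualCritical (gramMapOn hA B E) (traceFunctional Ψ hΨ.integrable)
      (covarianceFunctional E S) e) :
    stateCovariance A B (sandwich (1 + gramMapOn hA B E e) Ψ) = S := by
  set Δ := 1 + gramMapOn hA B E e with hΔ
  have hΦ := isSpectralDensity_sandwich he hΨ
  set D := stateCovariance A B (sandwich Δ Ψ) - S with hD
  -- Stationarity says that the covariance defect `D` is orthogonal to the symmetrized elements of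
  -- `E`.
  have hDE : ∀ Λ : E, ((Λ.1 + Λ.1ᴴ) * D).trace.re = 0 := by
    intro Λ
    have h1 := hc Λ
    have h2 : traceFunctional Ψ hΨ.integrable
        (Ring.inverse Δ * gramMapOn hA B E Λ * Ring.inverse Δ) =
        traceFunctional (sandwich Δ Ψ) hΦ.integrable (gramMap hA B Λ.1) := by
      rw [traceFunctional_apply, traceFunctional_apply]
      congr 1
      funext θ
      congr 1
      rw [sandwich, gramMapOn_apply]
      simp only [ContinuousMap.mul_apply]
      rw [Matrix.mul_assoc, Matrix.mul_assoc, Matrix.trace_mul_comm]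
      simp only [Matrix.mul_assoc]
    rw [h2, traceFunctional_gramMap, covarianceFunctional_apply] at h1
    rw [hD, Matrix.mul_sub, Matrix.trace_sub, Complex.sub_re, h1, sub_self]
  obtain ⟨⟨Φ₀, hΦ₀c, -, hΦ₀S⟩, hSpos⟩ := hS
  -- Multipliers in the kernel pair to zero with every covariance, and `S` is one because it lies in
  -- the range of `Γ`.
  have hDker : ∀ Λ ∈ LinearMap.ker (gramMap hA B), ((Λ + Λᴴ) * D).trace.re = 0 := by
    intro Λ hΛ
    have h0 : gramMap hA B Λ = 0 := hΛ
    rw [hD, Matrix.mul_sub, Matrix.trace_sub, Complex.sub_re,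
      ← traceFunctional_gramMap hA B hΦ.integrable, ← hΦ₀S,
      ← traceFunctional_gramMap hA B hΦ₀c.integrable_torus, h0, map_zero, map_zero, sub_zero]
  have hDH : Dᴴ = D := ((isHermitian_stateCovariance hA B hΦ).sub hSpos.isHermitian)
  obtain ⟨x, hx, y, hy, hxy⟩ : ∃ x ∈ LinearMap.ker (gramMap hA B), ∃ y ∈ E, x + y = D :=
    Submodule.mem_sup.mp (by rw [hE.sup_eq_top]; trivial)
  -- The kernel and `E` together span, so the Hermitian matrix `D` may be tested against itself.
  have h1 : ((D + Dᴴ) * D).trace.re = 0 := by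
    have e1 : D + Dᴴ = (x + xᴴ) + (y + yᴴ) := by
      rw [← hxy, Matrix.conjTranspose_add]; abel
    rw [e1, Matrix.add_mul, Matrix.trace_add, Complex.add_re, hDker x hx, hDE ⟨y, hy⟩, add_zero]
  have h2 : frobeniusSq D = 0 := by
    rw [Matrix.add_mul, Matrix.trace_add, Complex.add_re, hDH] at h1
    rw [frobeniusSq, hDH]; linarith
  have h3 := norm_sq_le_frobeniusSq D
  rw [h2] at h3
  have h4 : D = 0 := norm_eq_zero.mp (by nlinarith [norm_nonneg D])
  exact sub_eq_zero.mp h4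

/-- A stationary multiplier yields the solution of the Hellinger approximation problem. -/
theorem IsDualCritical.isHellingerOptimal (hA : IsStabilityMatrix A)
    (hE : IsCompl (LinearMap.ker (gramMap hA B)) E) (hΨ : IsSpectralDensity Ψ)
    (hS : S ∈ PGamma A B) {e : E} (he : e ∈ dualDomain (gramMapOn hA B E))
    (hc : IsDualCritical (gramMapOn hA B E) (traceFunctional Ψ hΨ.integrable)
      (covarianceFunctional E S) e) :
    IsHellingerOptimal A B Ψ S (sandwich (1 + gramMapOn hA B E e) Ψ) ∧
    ∀ Φ, IsHellingerOptimal A B Ψ S Φ →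
      Φ =ᵐ[torusMeasure] sandwich (1 + gramMapOn hA B E e) Ψ := by
  set Δ := 1 + gramMapOn hA B E e with hΔ
  have hfeas : sandwich Δ Ψ ∈ feasibleSpectra A B S :=
    ⟨isSpectralDensity_sandwich he hΨ, hc.stateCovariance_sandwich hA hE hΨ hS he⟩
  -- All feasible spectra lie on one hyperplane for `Δ - 1`, so they share the same lower bound on
  -- the distance.
  have hk : ∀ Φ ∈ feasibleSpectra A B S, ∫ θ, ((Δ θ - 1) * Φ θ).trace.re ∂torusMeasure =
      ((e.1 + e.1ᴴ) * S).trace.re := by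
    rintro Φ ⟨hΦ, hΦS⟩
    rw [← hΦS, ← traceFunctional_gramMap hA B hΦ.integrable, traceFunctional_apply]
    congr 1
    funext θ
    have h1 : Δ θ - 1 = gramMap hA B e.1 θ := add_sub_cancel_left 1 _
    rw [h1]
  refine ⟨⟨hfeas, fun Φ hΦ => ?_⟩, fun Φ hΦ => ?_⟩
  · refine (hellingerDist_sandwich_le he hΨ).2.trans ?_
    rw [hk _ hfeas, ← hk Φ hΦ]
    exact le_hellingerDist he hΨ hΦ.1
  · exact ae_eq_sandwich_of_hellingerDist_le he hΨ hΦ.1.1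
      ((hk Φ hΦ.1).trans (hk _ hfeas).symm) (hΦ.2 _ hfeas)

theorem exists_isDualCritical_gramMapOn (hA : IsStabilityMatrix A) (hB : B.rank = m)
    (hAB : IsReachablePair A B) (hE : IsCompl (LinearMap.ker (gramMap hA B)) E)
    (hΨ : IsSpectralDensity Ψ) (hS : S ∈ PGamma A B) :
    ∃ e ∈ dualDomain (gramMapOn hA B E), IsDualCritical (gramMapOn hA B E)
      (traceFunctional Ψ hΨ.integrable) (covarianceFunctional E S) e := by
  obtain ⟨Φ, hΦc, hΦpos, hΦS⟩ := exists_posDef_spectrum hA hB hAB hS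
  have hΦ := isSpectralDensity_of_continuous hΦc hΦpos
  refine exists_isDualCritical hΨ hΦ (fun e => isHermitian_gramMap hA B e.1)
    (gramMapOn_injective hA hE) (fun e => contDiff_quadForm_gramMap hA B e.1) fun e => ?_
  rw [gramMapOn_apply, traceFunctional_gramMap, hΦS, covarianceFunctional_apply]

theorem IsHellingerOptimal.hellingerOpt {Φ : UnitTorus → Matrix (Fin m) (Fin m) ℂ}
    (h : IsHellingerOptimal A B Ψ S Φ) : IsHellingerOptimal A B Ψ S (hellingerOpt A B Ψ S) := by
  have h1 : ∃ Φ, IsHellingerOptimal A B Ψ S Φ := ⟨Φ, h⟩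
  rw [_root_.hellingerOpt, dif_pos h1]
  exact h1.choose_spec

theorem norm_conj_sub_conj_le {R : Type*} [NormedRing R] (x y p : R) :
    ‖x * p * x - y * p * y‖ ≤ ‖x - y‖ * (‖p‖ * (‖x‖ + ‖y‖)) := by
  have e : x * p * x - y * p * y = (x - y) * p * x + y * p * (x - y) := by noncomm_ring
  rw [e]
  refine (norm_add_le _ _).trans ((add_le_add norm_mul₃_le norm_mul₃_le).trans_eq ?_)
  ring

theorem eventually_norm_inverse_sub_mul_lt {R : Type*} [NormedRing R] [CompleteSpace R] (u : Rˣ)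
    (C : ℝ) {ε : ℝ} (hε : 0 < ε) : ∀ᶠ x : R in 𝓝 (u : R),
      ‖Ring.inverse x - Ring.inverse (u : R)‖ *
        (C * (‖Ring.inverse x‖ + ‖Ring.inverse (u : R)‖)) < ε := by
  have hcont := NormedRing.inverse_continuousAt u
  have hlim := (tendsto_iff_norm_sub_tendsto_zero.mp hcont.tendsto).mul
    ((hcont.tendsto.norm.add_const ‖Ring.inverse (u : R)‖).const_mul C)
  rw [zero_mul] at hlim
  exact hlim.eventually (gt_mem_nhds hε)

/-- `Δ⁻¹ Ψ Δ⁻¹` depends continuously, in the uniform norm, on `Δ`. -/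
theorem eventually_norm_sandwich_sub_le (hΨ : IsSpectralDensity Ψ)
    {Δ₀ : C(UnitTorus, Matrix (Fin m) (Fin m) ℂ)} (h₀ : IsUnit Δ₀) {ε : ℝ} (hε : 0 < ε) :
    ∀ᶠ Δ in 𝓝 Δ₀, ∀ᵐ θ ∂torusMeasure, ‖sandwich Δ Ψ θ - sandwich Δ₀ Ψ θ‖ ≤ ε := by
  obtain ⟨C, hC⟩ := hΨ.exists_norm_le
  obtain ⟨u, rfl⟩ := h₀
  filter_upwards [eventually_norm_inverse_sub_mul_lt u (max C 0) hε] with Δ he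
  filter_upwards [hC] with θ hθ
  have n1 : ‖Ring.inverse Δ θ - Ring.inverse (u : C(UnitTorus, Matrix (Fin m) (Fin m) ℂ)) θ‖ ≤
      ‖Ring.inverse Δ - Ring.inverse (u : C(UnitTorus, Matrix (Fin m) (Fin m) ℂ))‖ := by
    rw [← ContinuousMap.sub_apply]; exact ContinuousMap.norm_coe_le_norm _ θ
  have n2 := (Ring.inverse Δ).norm_coe_le_norm θ
  have n3 := (Ring.inverse (u : C(UnitTorus, Matrix (Fin m) (Fin m) ℂ))).norm_coe_le_norm θ
  have n4 : ‖Ψ θ‖ ≤ max C 0 := hθ.trans (le_max_left _ _)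
  refine (norm_conj_sub_conj_le _ _ _).trans (le_trans ?_ he.le)
  exact mul_le_mul n1 (mul_le_mul n4 (add_le_add n2 n3)
    (add_nonneg (norm_nonneg _) (norm_nonneg _)) (le_max_right _ _))
    (mul_nonneg (norm_nonneg _) (add_nonneg (norm_nonneg _) (norm_nonneg _))) (norm_nonneg _)

/-- Existence and uniqueness of the Hellinger optimal spectrum. -/
theorem isHellingerOptimal_hellingerOpt (hA : IsStabilityMatrix A) (hB : B.rank = m)
    (hAB : IsReachablePair A B) (hΨ : IsSpectralDensity Ψ) (hS : S ∈ PGamma A B) :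
    IsHellingerOptimal A B Ψ S (hellingerOpt A B Ψ S) ∧
      ∀ Φ, IsHellingerOptimal A B Ψ S Φ → Φ =ᵐ[torusMeasure] hellingerOpt A B Ψ S := by
  obtain ⟨E, hE⟩ := exists_multiplierSpace hA B
  obtain ⟨e, he, hc⟩ := exists_isDualCritical_gramMapOn hA hB hAB hE hΨ hS
  obtain ⟨h1, h2⟩ := hc.isHellingerOptimal hA hE hΨ hS he
  exact ⟨h1.hellingerOpt, fun Φ hΦ => (h2 Φ hΦ).trans (h2 _ h1.hellingerOpt).symm⟩

/-- Stationary multipliers persist under small changes of the state covariance. -/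
theorem eventually_exists_isDualCritical (hA : IsStabilityMatrix A)
    (hE : IsCompl (LinearMap.ker (gramMap hA B)) E) (hΨ : IsSpectralDensity Ψ)
    {e₀ : E} (h₀ : e₀ ∈ dualDomain (gramMapOn hA B E))
    (hc₀ : IsDualCritical (gramMapOn hA B E) (traceFunctional Ψ hΨ.integrable)
      (covarianceFunctional E S) e₀) {ρ : ℝ} (hρ : 0 < ρ) :
    ∀ᶠ S' in 𝓝 S, ∃ e ∈ dualDomain (gramMapOn hA B E), ‖e - e₀‖ < ρ ∧
      IsDualCritical (gramMapOn hA B E) (traceFunctional Ψ hΨ.integrable)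
        (covarianceFunctional E S') e := by
  obtain ⟨δ, hδ, hnear⟩ := hc₀.exists_near hΨ (fun e => isHermitian_gramMap hA B e.1)
    (gramMapOn_injective hA hE) h₀ hρ
  have hcl := (tendsto_iff_norm_sub_tendsto_zero (E := E →L[ℝ] ℝ)).mp
    ((continuous_covarianceFunctional E).tendsto S)
  filter_upwards [hcl.eventually (gt_mem_nhds hδ)] with S' hS'
  exact hnear _ hS'

/-- Uniqueness identifies the chosen optimum with `Δ⁻¹ Ψ Δ⁻¹` almost everywhere, so the choice in
`hellingerOpt` is harmless. One space `E` serves all nearby covariances, and their multipliers can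
be compared. -/
theorem eventually_norm_hellingerOpt_sub_le (hA : IsStabilityMatrix A) (hB : B.rank = m)
    (hAB : IsReachablePair A B) (hΨ : IsSpectralDensity Ψ) (hS : S ∈ PGamma A B) {ε : ℝ}
    (hε : 0 < ε) : ∀ᶠ S' in 𝓝 S, S' ∈ PGamma A B → ∀ᵐ θ ∂torusMeasure,
      ‖hellingerOpt A B Ψ S' θ - hellingerOpt A B Ψ S θ‖ ≤ ε := by
  obtain ⟨E, hE⟩ := exists_multiplierSpace hA B
  obtain ⟨e₀, h₀, hc₀⟩ := exists_isDualCritical_gramMapOn hA hB hAB hE hΨ hS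
  have hcont : Tendsto (fun e => 1 + gramMapOn hA B E e) (𝓝 e₀)
      (𝓝 (1 + gramMapOn hA B E e₀)) :=
    (continuous_const.add (gramMapOn hA B E).continuous).tendsto e₀
  obtain ⟨ρ, hρ, hball⟩ := Metric.eventually_nhds_iff_ball.mp
    (hcont.eventually (eventually_norm_sandwich_sub_le hΨ (isUnit_of_posDef h₀) hε))
  filter_upwards [eventually_exists_isDualCritical hA hE hΨ h₀ hc₀ hρ] with S' hS' hS'P
  obtain ⟨e, he, hee₀, hce⟩ := hS'
  have h1 := (hce.isHellingerOptimal hA hE hΨ hS'P he).2 _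
    (isHellingerOptimal_hellingerOpt hA hB hAB hΨ hS'P).1
  have h2 := (hc₀.isHellingerOptimal hA hE hΨ hS h₀).2 _
    (isHellingerOptimal_hellingerOpt hA hB hAB hΨ hS).1
  filter_upwards [h1, h2, hball e (mem_ball_iff_norm.mpr hee₀)] with θ e1 e2 e3
  rwa [e1, e2]

/-- The Hellinger optimal spectrum depends continuously, in `L_∞`, on the state covariance. -/
theorem tendsto_matrixLinftyNorm_hellingerOpt (hA : IsStabilityMatrix A) (hB : B.rank = m)
    (hAB : IsReachablePair A B) (hΨ : IsSpectralDensity Ψ) (hS : S ∈ PGamma A B) {ι : Type*}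
    {f : Filter ι} {s : ι → Matrix (Fin n) (Fin n) ℂ} (hs : ∀ᶠ N in f, s N ∈ PGamma A B)
    (hlim : Tendsto s f (𝓝 S)) :
    Tendsto (fun N => matrixLinftyNorm (hellingerOpt A B Ψ (s N) - hellingerOpt A B Ψ S))
      f (𝓝 0) := by
  rw [ENNReal.tendsto_nhds_zero]
  intro ε hε
  -- The tolerance `ε` may be infinite; a finite positive `r` below it is used instead.
  obtain ⟨r, hr0, hrε⟩ := ENNReal.lt_iff_exists_nnreal_btwn.mp hε
  have hr : (0 : ℝ) < r := by exact_mod_cast hr0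
  filter_upwards [hlim.eventually (eventually_norm_hellingerOpt_sub_le hA hB hAB hΨ hS hr), hs]
    with N h1 h2
  refine le_trans (essSup_le_of_ae_le (r : ℝ≥0∞) ?_) hrε.le
  filter_upwards [h1 h2] with θ h3
  rw [Pi.sub_apply, ← ofReal_norm, Matrix.l2_opNorm_toEuclideanCLM]
  exact ENNReal.ofReal_le_of_le_toReal (by simpa using h3)

end Multipliers

theorem mainTheorem9 {n m : ℕ}
    (A : Matrix (Fin n) (Fin n) ℂ) (B : Matrix (Fin n) (Fin m) ℂ)
    (hA : IsStabilityMatrix A) (hB : B.rank = m) (hAB : IsReachablePair A B)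
    (Ψ : UnitTorus → Matrix (Fin m) (Fin m) ℂ) (hΨ : IsSpectralDensity Ψ) :
    -- on `P_Γ` the problem has exactly one solution (up to null sets), namely `Φ_opt^H(S)`
    (∀ S ∈ PGamma A B,
      IsHellingerOptimal A B Ψ S (hellingerOpt A B Ψ S) ∧
      ∀ Φ, IsHellingerOptimal A B Ψ S Φ → Φ =ᵐ[torusMeasure] hellingerOpt A B Ψ S) ∧
    -- strong consistency
    (∀ {Ω : Type*} [MeasurableSpace Ω] (P : Measure Ω) [IsProbabilityMeasure P]
      (S : Matrix (Fin n) (Fin n) ℂ) (Sbar : ℕ → Ω → Matrix (Fin n) (Fin n) ℂ),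
      S ∈ PGamma A B →
      (∀ N, ∀ᵐ ω ∂P, Sbar N ω ∈ PGamma A B) →
      (∀ᵐ ω ∂P, Tendsto (fun N => Sbar N ω) atTop (𝓝 S)) →
      ∀ᵐ ω ∂P, Tendsto
        (fun N => matrixLinftyNorm (hellingerOpt A B Ψ (Sbar N ω) - hellingerOpt A B Ψ S))
        atTop (𝓝 0)) := by
  refine ⟨fun S hS => isHellingerOptimal_hellingerOpt hA hB hAB hΨ hS, ?_⟩
  intro Ω _ P _ S Sbar hS hmem hlim
  -- The countably many exceptional sets have null union; off it and off the exceptional set of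
  -- `hlim`, the deterministic statement applies to each sample path.
  filter_upwards [ae_all_iff.mpr hmem, hlim] with ω h1 h2
  exact tendsto_matrixLinftyNorm_hellingerOpt hA hB hAB hΨ hS (Eventually.of_forall h1) h2
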